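/- Let $\psi:\mathbb{R}\to\mathbb{R}$ be a Sotomayor--Teixeira transition function, i.e. a $C^1$ function with $\psi'(v)>0$ for $|v|<1$, $\psi(v)=1$ for $v\ge 1$ and $\psi(v)=-1$ for $v\le -1$. For $a,\varepsilon>0$ consider the regularization of the linear-switching oscillator, $$\dot x=1,\qquad \varepsilon\dot v=-a\varepsilon v-f_L(x,\psi(v)),\qquad f_L(x,\lambda)=\bigl[1+(1+\lambda)\cos\pi x\bigr]\sin\tfrac{\pi x}{2},$$ where $v=y/\varepsilon$. Then there exist $a_0>0$ and $\varepsilon_0>0$ such that for all $a\in(0,a_0)$ and all $\varepsilon\in(0,\varepsilon_0)$ this system has a solution $t\mapsto(x(t),v(t))$, $t\in\mathbb{R}$, with the following properties. (i) It is $4$-periodic: $(x(t+4),v(t+4))=(x(t)+4,v(t))$ for all $t$, and $4$ is the least positive number with this property. (ii) It is non-sliding: whenever $|v(t)|<1$, there is no $w\in(-1,1)$ with $f_L(x(t),\psi(w))=0$. That is, the orbit is inside the switching layer $\{|v|<1\}$ only over values of $x$ over which the critical manifold $\{(x,w): f_L(x,\psi(w))=0,\ |w|<1\}$ has no point; in particular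 it never meets the critical manifold. (iii) It is locally asymptotically stable: its orbit $\Gamma=\{(x(t),v(t)):t\in\mathbb{R}\}$ is Lyapunov stable (for every $\eta>0$ there is $\delta>0$ such that every solution on $[0,\infty)$ starting at distance less than $\delta$ from $\Gamma$ stays at distance less than $\eta$ from $\Gamma$ for all $t\ge0$) and locally attracting (there is $\delta>0$ such that for every solution on $[0,\infty)$ starting at distance less than $\delta$ from $\Gamma$ the distance to $\Gamma$ tends to $0$ as $t\to\infty$). -/

import Mathlib

namespace SwitchedOscillator

/-- A Sotomayor–Teixeira transition function: a `C¹` function which is strictly increasing with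
positive derivative on `(-1, 1)` and coincides with the sign function for `|v| ≥ 1`. -/
structure IsTransition (ψ : ℝ → ℝ) : Prop where
  contDiff : ContDiff ℝ 1 ψ
  deriv_pos : ∀ v : ℝ, |v| < 1 → 0 < deriv ψ v
  eq_one : ∀ v : ℝ, 1 ≤ v → ψ v = 1
  eq_neg_one : ∀ v : ℝ, v ≤ -1 → ψ v = -1

/-- The linear-switching forcing
`f_L(x, l) = (1 + l)/2 * sin (3πx/2) + (1 - l)/2 * sin (πx/2)`, written in factorized form. -/
noncomputable def forcing (x l : ℝ) : ℝ :=
  (1 + (1 + l) * Real.cos (Real.pi * x)) * Real.sin (Real.pi * x / 2)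

/-- The planar vector field of the regularized system
`x' = 1`, `ε v' = -a ε v - f_L(x, ψ(v))`, where `v = y / ε`. -/
noncomputable def regField (ψ : ℝ → ℝ) (a ε : ℝ) (p : ℝ × ℝ) : ℝ × ℝ :=
  (1, (-(a * ε * p.2) - forcing p.1 (ψ p.2)) / ε)

/-- The critical manifold `{(x, v) : f_L(x, ψ(v)) = 0, |v| < 1}`, which replaces the sliding
manifold of the discontinuous system. -/
def criticalManifold (ψ : ℝ → ℝ) : Set (ℝ × ℝ) :=
  {p | forcing p.1 (ψ p.2) = 0 ∧ |p.2| < 1}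

/-- A curve does not slide if it is inside the switching layer `|v| < 1` only over abscissae `x`
over which the critical manifold has no point (that is, it traverses the layer over crossing
regions only). In particular it does not meet the critical manifold. -/
def NonSliding (ψ : ℝ → ℝ) (γ : ℝ → ℝ × ℝ) : Prop :=
  ∀ t : ℝ, |(γ t).2| < 1 → ∀ w : ℝ, ((γ t).1, w) ∉ criticalManifold ψ

/-- `γ` is `T`-periodic with least period `T`. The system is periodic in the phase `x`, which
advances by `T` while `v` returns to its value. -/
def HasLeastPeriod (γ : ℝ → ℝ × ℝ) (T : ℝ) : Prop :=
  0 < T ∧ (∀ t : ℝ, γ (t + T) = γ t + (T, 0)) ∧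
    ∀ S : ℝ, 0 < S → (∀ t : ℝ, γ (t + S) = γ t + (S, 0)) → T ≤ S

/-- Local asymptotic stability of a set `Γ` for the forward solutions of the autonomous system
with vector field `F`: Lyapunov stability together with local attractivity. -/
def IsLocallyAsymptoticallyStable (F : ℝ × ℝ → ℝ × ℝ) (Γ : Set (ℝ × ℝ)) : Prop :=
  (∀ η : ℝ, 0 < η → ∃ δ : ℝ, 0 < δ ∧
    ∀ σ : ℝ → ℝ × ℝ, IsIntegralCurveOn σ (fun _ => F) (Set.Ici 0) →
      Metric.infDist (σ 0) Γ < δ → ∀ t : ℝ, 0 ≤ t → Metric.infDist (σ t) Γ < η) ∧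
  ∃ δ : ℝ, 0 < δ ∧
    ∀ σ : ℝ → ℝ × ℝ, IsIntegralCurveOn σ (fun _ => F) (Set.Ici 0) →
      Metric.infDist (σ 0) Γ < δ →
        Filter.Tendsto (fun t => Metric.infDist (σ t) Γ) Filter.atTop (nhds 0)

end SwitchedOscillator

open Set Filter Topology Real
open scoped NNReal

/-! With y = εv and x as time the system reads dy/dx = -a y - f_L(x, ψ(y/ε)). The forcing is
4-periodic and odd in x, so reflecting x turns a solution on [-2, 0] into a solution on [0, 2] with
damping -a. Hence W is 4-periodic as soon as W(2) = W(-2), that is, as soon as the orbits with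
damping a and -a issued from the same height c at x = 0 reach the same height at x = 2. Without
damping every c works; damping selects one.

Crossing: over [3/10, 2/3 - 1/5000] both sin(3πx/2) and sin(πx/2) are positive, so f_L has no zero
there for any λ in [-1, 1]. For c between 2/(3π) and the height whose undamped orbit reaches y = 0
at 2/3 - 1/2000, the orbit goes down through the layer inside this window and stays below it until x
= 2 (`IsSol.exists_halfOrbit`).

Existence: the gap between the two orbits grows at rate a(Y + Z) where both are on the same side of
the layer. At the low end of the range the entry, near x = 1/3, is transversal and the long stretch
below the layer decides: the damped orbit ends higher (`lt_end_of_initial_eq_low`). At the high end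
the entry is almost tangent, a small gap becomes a long delay of entry, and the damped orbit ends
lower (`end_lt_of_initial_eq_high`). The intermediate value theorem gives the periodic orbit
(`exists_isSol_symmetric`).

Stability: up to the layer passage, the map from height at 0 to height at 2 with damping b has
derivative e^{-2b} times the ratio of exit to entry speed, about 1/(1 + 2 cos πq), which increases
with the entry phase q. The reversed orbit enters later (`entry_le_entry`), so its map expands more,
and the return map from x = -2 to x = 2 contracts (`end_sub_le_exp_mul`, `exists_contraction`).

Uniformity: in the layer the phase is written as a function of v, so all orbits see the same ψ(v)
and no bound on ψ' is needed. Only differences between orbits enter, so the layer errors in these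
comparisons are O(ε a) rather than O(ε), and the thresholds for a and ε are independent of each
other. -/

namespace SwitchedOscillator

/-! ### Global existence for scalar equations. -/

/-- A time-dependent scalar field which is uniformly Lipschitz in space and bounded on compact time
intervals has a global solution through every point. -/
theorem exists_global_solution {g : ℝ → ℝ → ℝ} {K : ℝ≥0} (hK : ∀ t, LipschitzWith K (g t))
    (hc : ∀ y, Continuous fun t => g t y)
    (hb : ∀ T : ℝ, ∃ M : ℝ≥0, ∀ t ∈ Icc (-T) T, ∀ y, ‖g t y‖ ≤ M) (t₀ y₀ : ℝ) :
    ∃ Y : ℝ → ℝ, Y t₀ = y₀ ∧ ∀ t, HasDerivAt Y (g t (Y t)) t := by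
  have hloc : ∀ T : ℝ, |t₀| < T → ∃ Y : ℝ → ℝ, Y t₀ = y₀ ∧
      ∀ t ∈ Ioo (-T) T, HasDerivAt Y (g t (Y t)) t := by
    intro T hT
    obtain ⟨M, hM⟩ := hb T
    have h0 := abs_lt.1 hT
    have hT0 : 0 < T := (abs_nonneg _).trans_lt hT
    have hP : IsPicardLindelof g (tmin := -T) (tmax := T) ⟨t₀, h0.1.le, h0.2.le⟩ y₀
        (M * ⟨2 * T, by positivity⟩) 0 M K :=
      { lipschitzOnWith := fun t _ => (hK t).lipschitzOnWith
        continuousOn := fun y _ => (hc y).continuousOn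
        norm_le := fun t ht y _ => hM t ht y
        mul_max_le := by
          push_cast
          rw [sub_zero]
          refine mul_le_mul_of_nonneg_left (max_le ?_ ?_) M.2
          · change T - t₀ ≤ 2 * T; linarith [h0.1]
          · change t₀ - -T ≤ 2 * T; linarith [h0.2] }
    obtain ⟨Y, hY0, hY⟩ := hP.exists_eq_forall_mem_Icc_hasDerivWithinAt₀
    exact ⟨Y, hY0, fun t ht => (hY t (Ioo_subset_Icc_self ht)).hasDerivAt
      (Icc_mem_nhds ht.1 ht.2)⟩
  choose! F hF0 hF using hloc
  have hagree : ∀ T T' : ℝ, |t₀| < T → T ≤ T' → ∀ z, |z| < T → F T z = F T' z := by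
    intro T T' hT hTT' z hz
    refine ODE_solution_unique_of_mem_Ioo (v := g) (s := fun _ => univ) (K := K) (t₀ := t₀)
      (a := -T) (b := T)
      (fun t _ => (hK t).lipschitzOnWith) (abs_lt.1 hT)
      (fun t ht => ⟨hF T hT t ht, mem_univ _⟩)
      (fun t ht => ⟨hF T' (hT.trans_le hTT') t ⟨by linarith [ht.1], by linarith [ht.2]⟩,
        mem_univ _⟩) ?_ (abs_lt.1 hz)
    rw [hF0 T hT, hF0 T' (hT.trans_le hTT')]
  have hagree' : ∀ T T' : ℝ, |t₀| < T → |t₀| < T' → ∀ z, |z| < T → |z| < T' →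
      F T z = F T' z := by
    intro T T' hT hT' z hz hz'
    rcases le_total T T' with h | h
    · exact hagree T T' hT h z hz
    · exact (hagree T' T hT' h z hz').symm
  have hpos : ∀ x : ℝ, |t₀| < |x| + |t₀| + 1 := fun x => by linarith [abs_nonneg x]
  have hlt : ∀ x : ℝ, |x| < |x| + |t₀| + 1 := fun x => by linarith [abs_nonneg t₀]
  -- Gluing: the value at x is read from the solution on an interval containing both x and t₀; near
  -- x all these solutions agree by `hagree'`.
  refine ⟨fun x => F (|x| + |t₀| + 1) x, hF0 _ (hpos _), fun x => ?_⟩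
  have hd := hF _ (hpos x) x (abs_lt.1 (hlt x))
  refine hd.congr_of_eventuallyEq ?_
  have hn : ∀ᶠ z in 𝓝 x, |z| < |x| + |t₀| + 1 :=
    (continuous_abs.tendsto x).eventually_lt_const (hlt x)
  filter_upwards [hn] with z hz
  exact hagree' _ _ (hpos z) (hpos x) z (hlt z) hz

/-! ### Bounds for transition functions. -/

namespace IsTransition

variable {ψ : ℝ → ℝ}

theorem strictMonoOn (hψ : IsTransition ψ) : StrictMonoOn ψ (Icc (-1) 1) := by
  refine strictMonoOn_of_deriv_pos (convex_Icc _ _) hψ.contDiff.continuous.continuousOn ?_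
  intro x hx
  rw [interior_Icc] at hx
  exact hψ.deriv_pos x (abs_lt.2 hx)

theorem abs_le_one (hψ : IsTransition ψ) (v : ℝ) : |ψ v| ≤ 1 := by
  rcases le_total 1 v with h | h
  · rw [hψ.eq_one v h]; simp
  rcases le_total v (-1) with h' | h'
  · rw [hψ.eq_neg_one v h']; simp
  have hm := hψ.strictMonoOn.monotoneOn
  have h1 := hm ⟨h', h⟩ (right_mem_Icc.2 (by norm_num)) h
  have h2 := hm (left_mem_Icc.2 (by norm_num)) ⟨h', h⟩ h'
  rw [hψ.eq_one 1 le_rfl] at h1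
  rw [hψ.eq_neg_one (-1) le_rfl] at h2
  exact abs_le.2 ⟨h2, h1⟩

theorem exists_lipschitzWith (hψ : IsTransition ψ) : ∃ K : ℝ≥0, LipschitzWith K ψ := by
  obtain ⟨C, hC⟩ := (isCompact_Icc (a := (-1 : ℝ)) (b := 1)).exists_bound_of_continuousOn
    (hψ.contDiff.continuous_deriv le_rfl).continuousOn
  refine ⟨⟨max C 0, le_max_right _ _⟩, lipschitzWith_of_nnnorm_deriv_le
    (hψ.contDiff.differentiable (by norm_num)) fun x => ?_⟩
  have key : ‖deriv ψ x‖ ≤ max C 0 := by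
    by_cases hx : x ∈ Icc (-1 : ℝ) 1
    · exact (hC x hx).trans (le_max_left _ _)
    · have h0 : deriv ψ x = 0 := by
        rcases lt_or_ge x (-1) with h | h
        · have : ψ =ᶠ[𝓝 x] fun _ => -1 := by
            filter_upwards [Iio_mem_nhds h] with z hz using hψ.eq_neg_one z (le_of_lt hz)
          rw [this.deriv_eq]; simp
        · have h1 : 1 < x := by
            by_contra hcon
            exact hx ⟨h, not_lt.1 hcon⟩
          have : ψ =ᶠ[𝓝 x] fun _ => 1 := by
            filter_upwards [Ioi_mem_nhds h1] with z hz using hψ.eq_one z (le_of_lt hz)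
          rw [this.deriv_eq]; simp
      rw [h0]; simp
  exact key

end IsTransition

/-! ### Symmetries and bounds of the forcing. -/

theorem sin_three_mul_half (x : ℝ) :
    sin (3 * π * x / 2) = (1 + 2 * cos (π * x)) * sin (π * x / 2) := by
  rw [show 3 * π * x / 2 = 3 * (π * x / 2) by ring, sin_three_mul,
    show cos (π * x) = cos (2 * (π * x / 2)) by ring_nf, cos_two_mul]
  linear_combination (-4 * sin (π * x / 2)) * sin_sq_add_cos_sq (π * x / 2)

theorem forcing_eq (x l : ℝ) :
    forcing x l = (1 + l) / 2 * sin (3 * π * x / 2) + (1 - l) / 2 * sin (π * x / 2) := by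
  rw [sin_three_mul_half, forcing]; ring

theorem forcing_one (x : ℝ) : forcing x 1 = sin (3 * π * x / 2) := by
  rw [forcing_eq]; ring

theorem forcing_neg_one (x : ℝ) : forcing x (-1) = sin (π * x / 2) := by
  rw [forcing_eq]; ring

theorem forcing_neg (x l : ℝ) : forcing (-x) l = -forcing x l := by
  have h1 : 3 * π * -x / 2 = -(3 * π * x / 2) := by ring
  have h2 : π * -x / 2 = -(π * x / 2) := by ring
  rw [forcing_eq, forcing_eq, h1, h2, sin_neg, sin_neg]; ring

theorem forcing_add_four (x l : ℝ) : forcing (x + 4) l = forcing x l := by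
  have h1 : π * (x + 4) = π * x + (2 : ℕ) * (2 * π) := by push_cast; ring
  have h2 : π * (x + 4) / 2 = π * x / 2 + 2 * π := by ring
  rw [forcing, forcing, h2, h1, cos_add_nat_mul_two_pi, sin_add_two_pi]

theorem abs_forcing_le_one (x : ℝ) {l : ℝ} (hl : |l| ≤ 1) : |forcing x l| ≤ 1 := by
  rw [forcing_eq]
  have := abs_le.1 hl
  have h1 := neg_one_le_sin (3 * π * x / 2)
  have h2 := sin_le_one (3 * π * x / 2)
  have h3 := neg_one_le_sin (π * x / 2)
  have h4 := sin_le_one (π * x / 2)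
  rw [abs_le]
  constructor <;> nlinarith

theorem abs_forcing_sub_le (x l l' : ℝ) : |forcing x l - forcing x l'| ≤ |l - l'| := by
  have : forcing x l - forcing x l' = (cos (π * x) * sin (π * x / 2)) * (l - l') := by
    simp only [forcing]; ring
  rw [this, abs_mul, abs_mul]
  have h := mul_le_mul (abs_cos_le_one (π * x)) (abs_sin_le_one (π * x / 2)) (abs_nonneg _)
    zero_le_one
  nlinarith [abs_nonneg (l - l')]

theorem continuous_forcing (l : ℝ) : Continuous fun x => forcing x l := by
  unfold forcing; fun_prop

/-! ### The scalar equation: existence, uniqueness, order and symmetries. -/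

/-- The scalar equation `dy/dx = -b y - f_L(x, ψ(y / ε))` for `y = ε v` as a function of the phase. -/
def IsSol (ψ : ℝ → ℝ) (b ε : ℝ) (Y : ℝ → ℝ) : Prop :=
  ∀ x, HasDerivAt Y (-(b * Y x) - forcing x (ψ (Y x / ε))) x

/-- Lipschitz constant, in `y`, of the right-hand side of the scalar equation. -/
theorem exists_lipschitz_field {ψ : ℝ → ℝ} (hψ : IsTransition ψ) (b : ℝ) {ε : ℝ} (hε : 0 < ε) :
    ∃ K : ℝ≥0, ∀ x, LipschitzWith K (fun y => -(b * y) - forcing x (ψ (y / ε))) := by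
  obtain ⟨C, hC⟩ := hψ.exists_lipschitzWith
  refine ⟨⟨|b| + C / ε, by positivity⟩, fun x => LipschitzWith.of_dist_le_mul fun y z => ?_⟩
  rw [Real.dist_eq, Real.dist_eq]
  have h1 := abs_forcing_sub_le x (ψ (y / ε)) (ψ (z / ε))
  have h2 := hC.dist_le_mul (y / ε) (z / ε)
  rw [Real.dist_eq, Real.dist_eq, ← sub_div, abs_div, abs_of_pos hε] at h2
  have h3 : -(b * y) - forcing x (ψ (y / ε)) - (-(b * z) - forcing x (ψ (z / ε)))
      = -(b * (y - z)) - (forcing x (ψ (y / ε)) - forcing x (ψ (z / ε))) := by ring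
  rw [h3]
  refine (abs_sub _ _).trans ?_
  rw [abs_neg, abs_mul]
  change _ ≤ (|b| + C / ε) * |y - z|
  have h4 : (C : ℝ) * (|y - z| / ε) = C / ε * |y - z| := by ring
  linarith

/-- The damping term is unbounded in y, so the integrating factor is applied first: u = e^{bx} y has
a field bounded on compact intervals, because |f_L| ≤ 1. The exponentials cancel in its Lipschitz
constant C/ε. -/
theorem exists_isSol {ψ : ℝ → ℝ} (hψ : IsTransition ψ) (b : ℝ) {ε : ℝ} (hε : 0 < ε) (x₀ y₀ : ℝ) :
    ∃ Y, IsSol ψ b ε Y ∧ Y x₀ = y₀ := by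
  obtain ⟨C, hC⟩ := hψ.exists_lipschitzWith
  have hψc := hψ.contDiff.continuous
  obtain ⟨U, hU0, hU⟩ := exists_global_solution (K := C / ⟨ε, hε.le⟩)
    (g := fun x u => -(exp (b * x) * forcing x (ψ (exp (-(b * x)) * u / ε))))
    (fun x => LipschitzWith.of_dist_le_mul fun u w => by
      rw [Real.dist_eq, Real.dist_eq]
      have h1 := abs_forcing_sub_le x (ψ (exp (-(b * x)) * u / ε)) (ψ (exp (-(b * x)) * w / ε))
      have h2 := hC.dist_le_mul (exp (-(b * x)) * u / ε) (exp (-(b * x)) * w / ε)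
      rw [Real.dist_eq, Real.dist_eq, ← sub_div, abs_div, abs_of_pos hε, ← mul_sub, abs_mul,
        abs_of_pos (exp_pos _)] at h2
      rw [show -(exp (b * x) * forcing x (ψ (exp (-(b * x)) * u / ε)))
        - -(exp (b * x) * forcing x (ψ (exp (-(b * x)) * w / ε))) = -(exp (b * x) *
          (forcing x (ψ (exp (-(b * x)) * u / ε)) - forcing x (ψ (exp (-(b * x)) * w / ε))))
          by ring, abs_neg, abs_mul, abs_of_pos (exp_pos _)]
      have h3 := mul_le_mul_of_nonneg_left (h1.trans h2) (exp_pos (b * x)).le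
      refine h3.trans (le_of_eq ?_)
      have h4 : exp (b * x) * exp (-(b * x)) = 1 := by rw [← exp_add]; simp
      change _ = (C : ℝ) / ε * |u - w|
      linear_combination (C : ℝ) * |u - w| / ε * h4)
    (fun u => by
      unfold forcing
      fun_prop)
    (fun T => ⟨⟨exp (|b| * T), (exp_pos _).le⟩, fun x hx u => by
      rw [norm_neg, Real.norm_eq_abs, abs_mul, abs_of_pos (exp_pos _)]
      have h1 := abs_forcing_le_one x (hψ.abs_le_one (exp (-(b * x)) * u / ε))
      have h2 : exp (b * x) ≤ exp (|b| * T) := by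
        refine exp_le_exp.2 ((le_abs_self _).trans ?_)
        rw [abs_mul]
        exact mul_le_mul_of_nonneg_left (abs_le.2 ⟨hx.1, hx.2⟩) (abs_nonneg b)
      change _ ≤ exp (|b| * T)
      nlinarith [exp_pos (b * x), abs_nonneg (forcing x (ψ (exp (-(b * x)) * u / ε)))]⟩)
    x₀ (exp (b * x₀) * y₀)
  refine ⟨fun x => exp (-(b * x)) * U x, fun x => ?_, ?_⟩
  · have h1 : HasDerivAt (fun x => exp (-(b * x))) (exp (-(b * x)) * -b) x := by
      have : HasDerivAt (fun x => -(b * x)) (-b) x := by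
        simpa [mul_comm] using (hasDerivAt_id x).mul_const (-b)
      exact this.exp
    refine (h1.mul (hU x)).congr_deriv ?_
    have h4 : exp (b * x) * exp (-(b * x)) = 1 := by rw [← exp_add]; simp
    linear_combination (-forcing x (ψ (exp (-(b * x)) * U x / ε))) * h4
  · simp only [hU0]
    rw [← mul_assoc, ← exp_add]; simp

namespace IsSol

variable {ψ : ℝ → ℝ} {b ε : ℝ} {Y Z : ℝ → ℝ}

theorem continuous (hY : IsSol ψ b ε Y) : Continuous Y :=
  continuous_iff_continuousAt.2 fun x => (hY x).continuousAt

/-- Oddness of the forcing in x. This lets the part of an orbit over [-2, 0] be studied as a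
half-orbit over [0, 2] with damping of the opposite sign. -/
theorem reflect (hY : IsSol ψ b ε Y) : IsSol ψ (-b) ε fun x => Y (-x) := by
  intro x
  have h := (hY (-x)).scomp x (hasDerivAt_neg x)
  refine h.congr_deriv ?_
  rw [forcing_neg]; simp only [smul_eq_mul]; ring

theorem shift (hY : IsSol ψ b ε Y) : IsSol ψ b ε fun x => Y (x + 4) := by
  intro x
  have h := (hY (x + 4)).comp_add_const x 4
  rwa [forcing_add_four] at h

theorem shift_neg (hY : IsSol ψ b ε Y) : IsSol ψ b ε fun x => Y (x - 4) := by
  intro x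
  have h := (hY (x - 4)).comp_sub_const x 4
  rwa [← forcing_add_four, sub_add_cancel] at h

theorem shift_int (hY : IsSol ψ b ε Y) (n : ℤ) : IsSol ψ b ε fun x => Y (x + 4 * n) := by
  induction n using Int.induction_on with
  | zero => simpa using hY
  | succ n ih =>
    convert ih.shift using 3
    push_cast; ring
  | pred n ih =>
    convert ih.shift_neg using 3
    push_cast; ring

theorem dist_le_forward (hY : IsSol ψ b ε Y) (hZ : IsSol ψ b ε Z) {K : ℝ≥0}
    (hK : ∀ x, LipschitzWith K (fun y => -(b * y) - forcing x (ψ (y / ε)))) {x₀ x : ℝ}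
    (hx : x₀ ≤ x) : |Y x - Z x| ≤ |Y x₀ - Z x₀| * exp (K * (x - x₀)) := by
  have := dist_le_of_trajectories_ODE (a := x₀) (b := x)
    (v := fun x y => -(b * y) - forcing x (ψ (y / ε))) hK
    hY.continuous.continuousOn (fun t _ => (hY t).hasDerivWithinAt)
    hZ.continuous.continuousOn (fun t _ => (hZ t).hasDerivWithinAt) le_rfl x (right_mem_Icc.2 hx)
  simpa only [Real.dist_eq] using this

theorem eq_of_eq_at (hψ : IsTransition ψ) (hε : 0 < ε) (hY : IsSol ψ b ε Y) (hZ : IsSol ψ b ε Z)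
    {x₀ : ℝ} (h : Y x₀ = Z x₀) : Y = Z := by
  obtain ⟨K, hK⟩ := exists_lipschitz_field hψ b hε
  exact ODE_solution_unique_univ (v := fun x y => -(b * y) - forcing x (ψ (y / ε)))
    (s := fun _ => univ) (fun t => (hK t).lipschitzOnWith)
    (fun t => ⟨hY t, mem_univ _⟩) (fun t => ⟨hZ t, mem_univ _⟩) h

theorem lt_of_lt_at (hψ : IsTransition ψ) (hε : 0 < ε) (hY : IsSol ψ b ε Y) (hZ : IsSol ψ b ε Z)
    {x₀ : ℝ} (h : Y x₀ < Z x₀) (x : ℝ) : Y x < Z x := by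
  by_contra hcon
  have hc : Continuous fun x => Z x - Y x := hZ.continuous.sub hY.continuous
  obtain ⟨z, hz⟩ := mem_range_of_exists_le_of_exists_ge hc (c := 0)
    ⟨x, by linarith [not_lt.1 hcon]⟩ ⟨x₀, by linarith⟩
  have := eq_of_eq_at hψ hε hY hZ (x₀ := z) (by simp only at hz; linarith)
  rw [this] at h
  exact lt_irrefl _ h

end IsSol

/-! ### Mean value and trigonometric estimates. -/

theorem image_sub_le_of_hasDerivAt {f f' : ℝ → ℝ} {p s C : ℝ} (hps : p ≤ s)
    (hf : ∀ x, HasDerivAt f (f' x) x) (hC : ∀ x ∈ Icc p s, f' x ≤ C) :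
    f s - f p ≤ C * (s - p) := by
  rcases hps.eq_or_lt with rfl | h
  · simp
  obtain ⟨z, hz, hs⟩ := exists_hasDerivAt_eq_slope f f' h
    (fun x _ => (hf x).continuousAt.continuousWithinAt) (fun x _ => hf x)
  have := hC z (Ioo_subset_Icc_self hz)
  rw [hs, div_le_iff₀ (by linarith)] at this
  exact this

theorem le_image_sub_of_hasDerivAt {f f' : ℝ → ℝ} {p s C : ℝ} (hps : p ≤ s)
    (hf : ∀ x, HasDerivAt f (f' x) x) (hC : ∀ x ∈ Icc p s, C ≤ f' x) :
    C * (s - p) ≤ f s - f p := by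
  have := image_sub_le_of_hasDerivAt (f := fun x => -f x) (f' := fun x => -f' x) (C := -C) hps
    (fun x => (hf x).neg) (fun x hx => neg_le_neg (hC x hx))
  linarith

theorem two_mul_le_sin_pi_mul {t : ℝ} (h0 : 0 ≤ t) (h1 : t ≤ 1 / 2) : 2 * t ≤ sin (π * t) := by
  have hπ := pi_pos
  have := mul_le_sin (x := π * t) (by positivity) (by nlinarith)
  have h2 : 2 / π * (π * t) = 2 * t := by field_simp
  linarith

theorem two_mul_one_sub_le_sin_pi_mul {t : ℝ} (h0 : 1 / 2 ≤ t) (h1 : t ≤ 1) :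
    2 * (1 - t) ≤ sin (π * t) := by
  have := two_mul_le_sin_pi_mul (t := 1 - t) (by linarith) (by linarith)
  rwa [show π * (1 - t) = π - π * t by ring, sin_pi_sub] at this

/-- The window stops short of the zero x = 2/3. Jordan's inequality gives 3x on the left half and
3(2/3 - x) ≥ 3/5000 on the right half. -/
theorem le_sin_three_half {x : ℝ} (h0 : 3 / 10 ≤ x) (h1 : x ≤ 2 / 3 - 1 / 5000) :
    1 / 2000 ≤ sin (3 * π * x / 2) := by
  rw [show 3 * π * x / 2 = π * (3 * x / 2) by ring]
  rcases le_total (3 * x / 2) (1 / 2) with h | h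
  · linarith [two_mul_le_sin_pi_mul (t := 3 * x / 2) (by linarith) h]
  · linarith [two_mul_one_sub_le_sin_pi_mul (t := 3 * x / 2) h (by linarith)]

theorem le_sin_half {x : ℝ} (h0 : 0 ≤ x) (h1 : x ≤ 1) : x ≤ sin (π * x / 2) := by
  rw [show π * x / 2 = π * (x / 2) by ring]
  linarith [two_mul_le_sin_pi_mul (t := x / 2) (by linarith) (by linarith)]

/-- A convex combination of two positive sines. It gives both the downward crossing and the absence
of critical points over the window. -/
theorem le_forcing {x l : ℝ} (h0 : 3 / 10 ≤ x) (h1 : x ≤ 2 / 3 - 1 / 5000) (hl : |l| ≤ 1) :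
    1 / 2000 ≤ forcing x l := by
  have h2 := le_sin_three_half h0 h1
  have h3 := le_sin_half (x := x) (by linarith) (by linarith)
  rw [forcing_eq]
  have := abs_le.1 hl
  nlinarith

theorem hasDerivAt_cos_three_half (x : ℝ) :
    HasDerivAt (fun x => 2 / (3 * π) * cos (3 * π * x / 2)) (-sin (3 * π * x / 2)) x := by
  have h : HasDerivAt (fun x => 3 * π * x / 2) (3 * π / 2) x := by
    simpa using ((hasDerivAt_id x).const_mul (3 * π)).div_const 2
  refine (h.cos.const_mul (2 / (3 * π))).congr_deriv ?_
  field_simp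

theorem hasDerivAt_cos_half (x : ℝ) :
    HasDerivAt (fun x => 2 / π * cos (π * x / 2)) (-sin (π * x / 2)) x := by
  have h : HasDerivAt (fun x => π * x / 2) (π / 2) x := by
    simpa using ((hasDerivAt_id x).const_mul π).div_const 2
  refine (h.cos.const_mul (2 / π)).congr_deriv ?_
  field_simp

/-- Quantitative monotonicity of `cos (3πx/2)` near its minimum at `x = 2/3`. -/
theorem cos_three_half_sub_ge {x y : ℝ} (h0 : 1 / 3 ≤ x) (h1 : x ≤ y) (h2 : y ≤ 2 / 3) :
    9 / 2 * ((2 / 3 - x) ^ 2 - (2 / 3 - y) ^ 2) ≤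
      cos (3 * π * x / 2) - cos (3 * π * y / 2) := by
  rw [cos_sub_cos]
  have e1 : (3 * π * x / 2 + 3 * π * y / 2) / 2 = π * (3 * (x + y) / 4) := by ring
  have e2 : (3 * π * x / 2 - 3 * π * y / 2) / 2 = -(π * (3 * (y - x) / 4)) := by ring
  rw [e1, e2, sin_neg]
  have s1 := two_mul_one_sub_le_sin_pi_mul (t := 3 * (x + y) / 4) (by linarith) (by linarith)
  have s2 := two_mul_le_sin_pi_mul (t := 3 * (y - x) / 4) (by linarith) (by linarith)
  have := mul_le_mul s1 s2 (by linarith) (by linarith)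
  nlinarith

/-- The first time at which a continuous function falls to the level `e`. -/
theorem exists_first_crossing {f : ℝ → ℝ} (hf : Continuous f) {p s e : ℝ} (h0 : e < f p)
    (hps : p ≤ s) (h1 : f s ≤ e) :
    ∃ q ∈ Icc p s, f q = e ∧ ∀ x ∈ Icc p q, e ≤ f x := by
  have hcl : IsCompact (Icc p s ∩ {x | f x ≤ e}) :=
    isCompact_Icc.inter_right (isClosed_le hf continuous_const)
  obtain ⟨q, hq, hleast⟩ := hcl.exists_isLeast ⟨s, right_mem_Icc.2 hps, h1⟩
  have hlt : ∀ x ∈ Ico p q, e < f x := by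
    intro x hx
    by_contra hcon
    have := hleast ⟨⟨hx.1, hx.2.le.trans hq.1.2⟩, not_lt.1 hcon⟩
    exact absurd hx.2 (not_lt.2 this)
  have hpq : p < q := by
    rcases hq.1.1.eq_or_lt with h | h
    · have := hq.2
      rw [← h] at this
      exact absurd h0 (not_lt.2 this)
    · exact h
  have hge : e ≤ f q := by
    have : closure (Ico p q) ⊆ {x | e ≤ f x} :=
      closure_minimal (fun x hx => (hlt x hx).le) (isClosed_le continuous_const hf)
    rw [closure_Ico hpq.ne] at this
    exact this (right_mem_Icc.2 hpq.le)
  refine ⟨q, hq.1, le_antisymm hq.2 hge, fun x hx => ?_⟩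
  rcases hx.2.eq_or_lt with rfl | h
  · exact hge
  · exact (hlt x ⟨hx.1, h⟩).le

/-! ### Existence of crossing half-orbits. -/

/-- The part over `0 ≤ x ≤ 2` of a crossing orbit: it stays above the layer on `[0, q]`, traverses it
downwards on `[q, r]`, and stays below it on `[r, 2]`. -/
structure HalfOrbit (ψ : ℝ → ℝ) (b ε : ℝ) (Y : ℝ → ℝ) (q r : ℝ) : Prop where
  transition : IsTransition ψ
  eps_pos : 0 < ε
  eps_le : ε ≤ 1 / 10 ^ 30
  abs_damping_le : |b| ≤ 1 / 10 ^ 30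
  sol : IsSol ψ b ε Y
  le_q : 3 / 10 ≤ q
  q_le : q ≤ 2 / 3 - 1 / 4000
  q_le_r : q ≤ r
  r_le : r ≤ 2 / 3 - 1 / 5000
  upper : ∀ x ∈ Icc 0 q, ε ≤ Y x
  lower : ∀ x ∈ Icc r 2, Y x ≤ -ε
  at_q : Y q = ε
  at_r : Y r = -ε
  abs_le : ∀ x ∈ Icc (0 : ℝ) 2, |Y x| ≤ 3

theorem IsSol.abs_le_three {ψ : ℝ → ℝ} (hψ : IsTransition ψ) {b ε : ℝ}
    (hb : |b| ≤ 1 / 10 ^ 30) {Y : ℝ → ℝ} (hY : IsSol ψ b ε Y) (h0 : |Y 0| ≤ 1 / 2) :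
    ∀ x ∈ Icc (0 : ℝ) 2, |Y x| ≤ 3 := by
  intro x hx
  have hg := norm_le_gronwallBound_of_norm_deriv_right_le (f := Y)
    (f' := fun x => -(b * Y x) - forcing x (ψ (Y x / ε))) (δ := 1 / 2) (K := 1 / 100) (ε := 1)
    (a := 0) (b := 2) hY.continuous.continuousOn (fun x _ => (hY x).hasDerivWithinAt) h0
    (fun x _ => by
      have h1 := abs_forcing_le_one x (hψ.abs_le_one (Y x / ε))
      rw [Real.norm_eq_abs, Real.norm_eq_abs]
      refine (abs_sub _ _).trans ?_
      rw [abs_neg, abs_mul]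
      have : |b| * |Y x| ≤ 1 / 100 * |Y x| :=
        mul_le_mul_of_nonneg_right (hb.trans (by norm_num)) (abs_nonneg _)
      linarith) x hx
  rw [gronwallBound_of_K_ne_0 (by norm_num)] at hg
  rw [Real.norm_eq_abs] at hg
  -- Obtained from 1 + u ≤ e^u at u = -1/50. The Gronwall bound is then at most 25/49 + 100/49 < 3.
  have he : exp (1 / 100 * (x - 0)) ≤ 50 / 49 := by
    have h1 : exp (1 / 100 * (x - 0)) ≤ exp (1 / 50) := exp_le_exp.2 (by linarith [hx.2])
    have h2 := add_one_le_exp (-(1 / 50 : ℝ))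
    rw [exp_neg] at h2
    have h3 : exp (1 / 50 : ℝ) * (exp (1 / 50))⁻¹ = 1 := mul_inv_cancel₀ (exp_pos _).ne'
    nlinarith [exp_pos (1 / 50 : ℝ)]
  norm_num at hg he
  linarith

namespace IsSol

variable {ψ : ℝ → ℝ} {b ε : ℝ} {Y : ℝ → ℝ} {q r : ℝ}

/-- Above the layer ψ = 1 and the undamped equation integrates explicitly; the damping adds at most
3|b| per unit of phase, over a length at most 2. -/
theorem abs_sub_upper_le (hψ : IsTransition ψ) (hε : 0 < ε) (hY : IsSol ψ b ε Y)
    (h3 : ∀ x ∈ Icc (0 : ℝ) 2, |Y x| ≤ 3) (hq : q ≤ 2) (hup : ∀ x ∈ Icc 0 q, ε ≤ Y x) {x : ℝ}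
    (hx : x ∈ Icc 0 q) :
    |Y x - (Y 0 + 2 / (3 * π) * (cos (3 * π * x / 2) - 1))| ≤ 6 * |b| := by
  have hd : ∀ z, HasDerivAt (fun z => Y z - 2 / (3 * π) * cos (3 * π * z / 2))
      (-(b * Y z) - forcing z (ψ (Y z / ε)) - -sin (3 * π * z / 2)) z :=
    fun z => (hY z).sub (hasDerivAt_cos_three_half z)
  have hval : ∀ z ∈ Icc 0 x, |-(b * Y z) - forcing z (ψ (Y z / ε)) - -sin (3 * π * z / 2)|
      ≤ 3 * |b| := by
    intro z hz
    have hzq : z ∈ Icc 0 q := ⟨hz.1, hz.2.trans hx.2⟩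
    rw [hψ.eq_one (Y z / ε) (by rw [le_div_iff₀ hε]; linarith [hup z hzq]), forcing_one]
    have := h3 z ⟨hz.1, hzq.2.trans hq⟩
    rw [show -(b * Y z) - sin (3 * π * z / 2) - -sin (3 * π * z / 2) = -(b * Y z) by ring,
      abs_neg, abs_mul]
    nlinarith [abs_nonneg b]
  have h1 := image_sub_le_of_hasDerivAt hx.1 hd (fun z hz => (abs_le.1 (hval z hz)).2)
  have h2 := le_image_sub_of_hasDerivAt hx.1 hd (fun z hz => (abs_le.1 (hval z hz)).1)
  simp only [mul_zero, zero_div, cos_zero, mul_one, sub_zero] at h1 h2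
  have hb := abs_nonneg b
  have h4 := hx.2
  have h5 := hx.1
  rw [abs_le]
  constructor <;> nlinarith

theorem deriv_le_of_window (hψ : IsTransition ψ) (hb : |b| ≤ 1 / 10 ^ 30)
    (h3 : ∀ x ∈ Icc (0 : ℝ) 2, |Y x| ≤ 3) {x : ℝ} (h0 : 3 / 10 ≤ x)
    (h1 : x ≤ 2 / 3 - 1 / 5000) :
    -(b * Y x) - forcing x (ψ (Y x / ε)) ≤ -(1 / 4000) := by
  have h2 := le_forcing h0 h1 (hψ.abs_le_one (Y x / ε))
  have h4 := h3 x ⟨by linarith, by linarith⟩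
  have h5 : |b * Y x| ≤ 1 / 10 ^ 30 * 3 := by
    rw [abs_mul]
    exact mul_le_mul hb h4 (abs_nonneg _) (by norm_num)
  have := (abs_le.1 h5).1
  norm_num at this
  linarith

theorem sub_le_of_window (hψ : IsTransition ψ) (hb : |b| ≤ 1 / 10 ^ 30) (hY : IsSol ψ b ε Y)
    (h3 : ∀ x ∈ Icc (0 : ℝ) 2, |Y x| ≤ 3) {x y : ℝ} (h0 : 3 / 10 ≤ x) (hxy : x ≤ y)
    (h1 : y ≤ 2 / 3 - 1 / 5000) :
    Y y - Y x ≤ -(1 / 4000) * (y - x) :=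
  image_sub_le_of_hasDerivAt hxy hY
    (fun _ hz => deriv_le_of_window hψ hb h3 (h0.trans hz.1) (hz.2.trans h1))

/-- Initial values in `[2/(3π), 2/(3π) (1 - cos (3π q_H / 2))]` with `q_H = 2/3 - 1/2000` give
crossing half-orbits. -/
theorem exists_halfOrbit (hψ : IsTransition ψ) (hε : 0 < ε) (hε1 : ε ≤ 1 / 10 ^ 30)
    (hb : |b| ≤ 1 / 10 ^ 30) (hY : IsSol ψ b ε Y) (hL : 2 / (3 * π) ≤ Y 0)
    (hH : Y 0 ≤ 2 / (3 * π) * (1 - cos (3 * π * (2 / 3 - 1 / 2000) / 2))) :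
    ∃ q r, HalfOrbit ψ b ε Y q r := by
  have hε2 : ε ≤ 1 / 10 ^ 15 := hε1.trans (by norm_num)
  have hb2 : |b| ≤ 1 / 10 ^ 15 := hb.trans (by norm_num)
  norm_num at hε2 hb2
  have hπ3 := pi_gt_three
  have hπ4 := pi_le_four
  have hk1 : 1 / 6 ≤ 2 / (3 * π) := by
    rw [le_div_iff₀ (by positivity)]; linarith
  have hk2 : 2 / (3 * π) ≤ 1 / 4 := by
    rw [div_le_iff₀ (by positivity)]; linarith
  have h0 : |Y 0| ≤ 1 / 2 := by
    have := neg_one_le_cos (3 * π * (2 / 3 - 1 / 2000) / 2)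
    rw [_root_.abs_le]
    constructor <;> nlinarith
  have h3 := hY.abs_le_three hψ hb h0
  have hgap := cos_three_half_sub_ge (x := 2 / 3 - 1 / 2000) (y := 2 / 3 - 1 / 4000) (by norm_num)
    (by norm_num) (by norm_num)
  obtain ⟨q, hq, hYq, hup⟩ : ∃ q ∈ Icc (0 : ℝ) (2 / 3 - 1 / 4000), Y q = ε ∧
      ∀ x ∈ Icc 0 q, ε ≤ Y x := by
    by_cases hex : ∃ s ∈ Icc (0 : ℝ) (2 / 3 - 1 / 4000), Y s ≤ ε
    · obtain ⟨s, hs, hYs⟩ := hex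
      obtain ⟨q, hq, h⟩ := exists_first_crossing hY.continuous (e := ε) (by linarith) hs.1 hYs
      exact ⟨q, ⟨hq.1, hq.2.trans hs.2⟩, h⟩
    · push Not at hex
      -- An orbit still above the layer at 2/3 - 1/4000 would follow the explicit primitive, which
      -- is already negative there: even the highest admissible start has its undamped zero at 2/3 -
      -- 1/2000.
      exfalso
      have h1 := hY.abs_sub_upper_le hψ hε h3 (q := 2 / 3 - 1 / 4000) (by norm_num)
        (fun x hx => (hex x hx).le) (x := 2 / 3 - 1 / 4000) ⟨by norm_num, le_rfl⟩
      have h2 := (_root_.abs_le.1 h1).2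
      have h4 := hex (2 / 3 - 1 / 4000) ⟨by norm_num, le_rfl⟩
      generalize cos (3 * π * (2 / 3 - 1 / 4000) / 2) = A at *
      generalize cos (3 * π * (2 / 3 - 1 / 2000) / 2) = B at *
      norm_num at hgap
      nlinarith
  -- The undamped orbit of the lowest admissible start vanishes only at x = 1/3, so at any phase
  -- before 3/10 the orbit is still well above ε.
  have hq3 : 3 / 10 ≤ q := by
    by_contra hcon
    have h1 := hY.abs_sub_upper_le hψ hε h3 (by linarith [hq.2]) hup (x := q) ⟨hq.1, le_rfl⟩
    have h2 := (_root_.abs_le.1 h1).1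
    have h5 : cos (3 * π * (3 / 10) / 2) ≤ cos (3 * π * q / 2) := by
      apply cos_le_cos_of_nonneg_of_le_pi
      · have := hq.1; positivity
      · linarith
      · nlinarith
    have h6 := two_mul_le_sin_pi_mul (t := 1 / 20) (by norm_num) (by norm_num)
    rw [show π * (1 / 20) = π / 2 - 3 * π * (3 / 10) / 2 by ring, sin_pi_div_two_sub] at h6
    nlinarith
  have hmono : ∀ x y, 3 / 10 ≤ x → x ≤ y → y ≤ 2 / 3 - 1 / 5000 →
      Y y - Y x ≤ -(1 / 4000) * (y - x) := fun x y => hY.sub_le_of_window hψ hb h3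
  have hend : Y (2 / 3 - 1 / 5000) < -ε := by
    have := hmono q (2 / 3 - 1 / 5000) hq3 (by linarith [hq.2]) le_rfl
    have := hq.2
    nlinarith
  obtain ⟨r, hr, hYr⟩ : ∃ r ∈ Icc q (2 / 3 - 1 / 5000), Y r = -ε := by
    have := intermediate_value_Icc' (f := Y) (a := q) (b := 2 / 3 - 1 / 5000)
      (by linarith [hq.2]) hY.continuous.continuousOn
    obtain ⟨r, hr, h⟩ := this ⟨hend.le, by rw [hYq]; linarith⟩
    exact ⟨r, hr, h⟩
  have hlow : ∀ x ∈ Icc r 2, Y x ≤ -ε := by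
    intro x hx
    rcases le_total x (2 / 3 - 1 / 5000) with h | h
    · have := hmono r x (hq3.trans hr.1) hx.1 h
      nlinarith [hx.1]
    -- A return to the layer before x = 2 is impossible: below it the orbit follows (2/π) cos(πx/2),
    -- which decreases on [0, 2] faster than damping can raise y.
    by_contra hcon
    have hcon := not_le.1 hcon
    obtain ⟨s, hs, hYs, hls⟩ := exists_first_crossing (f := fun x => -Y x) hY.continuous.neg
      (e := ε) (p := 2 / 3 - 1 / 5000) (s := x) (by linarith) h (by linarith)
    have hd : ∀ z, HasDerivAt (fun z => Y z - 2 / π * cos (π * z / 2))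
      (-(b * Y z) - forcing z (ψ (Y z / ε)) - -sin (π * z / 2)) z :=
        fun z => (hY z).sub (hasDerivAt_cos_half z)
    have h1 := image_sub_le_of_hasDerivAt hs.1 hd (C := 3 * |b|) (fun z hz => by
      have hz1 := hls z hz
      rw [hψ.eq_neg_one (Y z / ε) (by rw [div_le_iff₀ hε]; linarith), forcing_neg_one]
      have := h3 z ⟨by linarith [hz.1], by linarith [hz.2, hs.2, hx.2]⟩
      have h4 := neg_abs_le (b * Y z)
      rw [abs_mul] at h4
      nlinarith [abs_nonneg b])
    have hcs : 3 / 5 * (s - (2 / 3 - 1 / 5000)) ≤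
        cos (π * (2 / 3 - 1 / 5000) / 2) - cos (π * s / 2) := by
      rw [cos_sub_cos]
      have e1 : (π * (2 / 3 - 1 / 5000) / 2 + π * s / 2) / 2
        = π * ((s + (2 / 3 - 1 / 5000)) / 4) := by ring
      have e2 : (π * (2 / 3 - 1 / 5000) / 2 - π * s / 2) / 2
        = -(π * ((s - (2 / 3 - 1 / 5000)) / 4)) := by ring
      rw [e1, e2, sin_neg]
      have hs2 : s ≤ 2 := hs.2.trans hx.2
      have s1 : 6 / 10 ≤ sin (π * ((s + (2 / 3 - 1 / 5000)) / 4)) := by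
        rcases le_total ((s + (2 / 3 - 1 / 5000)) / 4) (1 / 2) with h | h
        · have := two_mul_le_sin_pi_mul (by linarith [hs.1]) h
          linarith [hs.1]
        · have := two_mul_one_sub_le_sin_pi_mul h (by linarith)
          linarith
      have s2 := two_mul_le_sin_pi_mul (t := (s - (2 / 3 - 1 / 5000)) / 4)
        (by linarith [hs.1]) (by linarith)
      have := mul_le_mul s1 s2 (by linarith [hs.1]) (by linarith)
      nlinarith
    have hk3 : 1 / 2 ≤ 2 / π := by
      rw [le_div_iff₀ (by positivity)]; linarith
    have hYs' : Y s = -ε := by linarith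
    simp only [hYs'] at h1
    have hs0 := hs.1
    generalize cos (π * (2 / 3 - 1 / 5000) / 2) = A at *
    generalize cos (π * s / 2) = B at *
    nlinarith [mul_le_mul hk3 hcs (by linarith) (by positivity)]
  exact ⟨q, r, ⟨hψ, hε, hε1, hb, hY, hq3, hq.2, hr.1, hr.2, hup, hlow, hYq, hYr, h3⟩⟩

end IsSol

/-! ### Passage through the layer, parametrized by v. -/

/-- The partial derivative of the forcing with respect to the phase. -/
noncomputable def forcingDeriv (x l : ℝ) : ℝ :=
  (1 + l) / 2 * (3 * π / 2 * cos (3 * π * x / 2)) + (1 - l) / 2 * (π / 2 * cos (π * x / 2))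

theorem hasDerivAt_forcing (x l : ℝ) :
    HasDerivAt (fun x => forcing x l) (forcingDeriv x l) x := by
  have h1 : HasDerivAt (fun x => 3 * π * x / 2) (3 * π / 2) x := by
    simpa using ((hasDerivAt_id x).const_mul (3 * π)).div_const 2
  have h2 : HasDerivAt (fun x => π * x / 2) (π / 2) x := by
    simpa using ((hasDerivAt_id x).const_mul π).div_const 2
  have h3 := (h1.sin.const_mul ((1 + l) / 2)).add (h2.sin.const_mul ((1 - l) / 2))
  have h4 : (fun x => forcing x l) = (fun x => (1 + l) / 2 * sin (3 * π * x / 2)) +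
      fun x => (1 - l) / 2 * sin (π * x / 2) := by
    funext z; simp [forcing_eq]
  rw [h4]
  refine h3.congr_deriv ?_
  unfold forcingDeriv; ring

theorem abs_convex_comb_le {l A B M : ℝ} (hl : |l| ≤ 1) (hA : |A| ≤ M) (hB : |B| ≤ M) :
    |(1 + l) / 2 * A + (1 - l) / 2 * B| ≤ M := by
  rw [abs_le] at *
  constructor <;> nlinarith

theorem abs_forcingDeriv_le (x : ℝ) {l : ℝ} (hl : |l| ≤ 1) : |forcingDeriv x l| ≤ 5 := by
  have hπ := pi_lt_d2
  have hπ0 := pi_pos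
  refine abs_convex_comb_le hl ?_ ?_ <;> rw [abs_mul, abs_of_pos (by positivity)]
  · nlinarith [abs_cos_le_one (3 * π * x / 2), abs_nonneg (cos (3 * π * x / 2))]
  · nlinarith [abs_cos_le_one (π * x / 2), abs_nonneg (cos (π * x / 2))]

theorem abs_forcingDeriv_sub_le (x y : ℝ) {l : ℝ} (hl : |l| ≤ 1) :
    |forcingDeriv x l - forcingDeriv y l| ≤ 25 * |x - y| := by
  have hπ := pi_lt_d2
  have hπ0 := pi_pos
  have h1 := abs_cos_sub_cos_le (3 * π * x / 2) (3 * π * y / 2)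
  have h2 := abs_cos_sub_cos_le (π * x / 2) (π * y / 2)
  rw [show 3 * π * x / 2 - 3 * π * y / 2 = 3 * π / 2 * (x - y) by ring, abs_mul,
    abs_of_pos (by positivity : 0 < 3 * π / 2)] at h1
  rw [show π * x / 2 - π * y / 2 = π / 2 * (x - y) by ring, abs_mul,
    abs_of_pos (by positivity : 0 < π / 2)] at h2
  have h3 := abs_nonneg (x - y)
  have e : forcingDeriv x l - forcingDeriv y l =
      (1 + l) / 2 * (3 * π / 2 * (cos (3 * π * x / 2) - cos (3 * π * y / 2))) +
      (1 - l) / 2 * (π / 2 * (cos (π * x / 2) - cos (π * y / 2))) := by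
    unfold forcingDeriv; ring
  rw [e]
  have hsq : (3 * π / 2) * (3 * π / 2) ≤ 25 := by nlinarith
  have hsq' : (π / 2) * (π / 2) ≤ 25 := by nlinarith
  refine abs_convex_comb_le hl ?_ ?_ <;> rw [abs_mul, abs_of_pos (by positivity)]
  · calc _ ≤ 3 * π / 2 * (3 * π / 2 * |x - y|) := mul_le_mul_of_nonneg_left h1 (by positivity)
      _ = (3 * π / 2) * (3 * π / 2) * |x - y| := by ring
      _ ≤ _ := mul_le_mul_of_nonneg_right hsq h3
  · calc _ ≤ π / 2 * (π / 2 * |x - y|) := mul_le_mul_of_nonneg_left h2 (by positivity)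
      _ = (π / 2) * (π / 2) * |x - y| := by ring
      _ ≤ _ := mul_le_mul_of_nonneg_right hsq' h3

theorem abs_forcing_sub_forcing_le (x y : ℝ) {l : ℝ} (hl : |l| ≤ 1) :
    |forcing x l - forcing y l| ≤ 5 * |x - y| := by
  have h := Convex.norm_image_sub_le_of_norm_hasDerivWithin_le (f := fun x => forcing x l) (C := 5)
    (s := univ) (x := y) (y := x) (fun z _ => (hasDerivAt_forcing z l).hasDerivWithinAt)
    (fun z _ => abs_forcingDeriv_le z hl) convex_univ (mem_univ _) (mem_univ _)
  simpa only [Real.norm_eq_abs] using h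

/-- The layer part of a half-orbit, with the phase written as a function of `v = y / ε`. -/
structure LayerCurve (ψ : ℝ → ℝ) (b ε q r : ℝ) (Y X : ℝ → ℝ) : Prop where
  mem : ∀ v ∈ Icc (-1 : ℝ) 1, X v ∈ Icc q r
  comp : ∀ v ∈ Icc (-1 : ℝ) 1, Y (X v) = ε * v
  one : X 1 = q
  neg_one : X (-1) = r
  continuousOn : ContinuousOn X (Icc (-1) 1)
  hasDerivAt : ∀ v ∈ Ioo (-1 : ℝ) 1,
    HasDerivAt X (-(ε / (forcing (X v) (ψ v) + b * ε * v))) v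

namespace HalfOrbit

variable {ψ : ℝ → ℝ} {b ε : ℝ} {Y : ℝ → ℝ} {q r : ℝ}

theorem sub_le (h : HalfOrbit ψ b ε Y q r) {x y : ℝ} (h0 : 3 / 10 ≤ x) (hxy : x ≤ y)
    (h1 : y ≤ 2 / 3 - 1 / 5000) : Y y - Y x ≤ -(1 / 4000) * (y - x) :=
  h.sol.sub_le_of_window h.transition h.abs_damping_le h.abs_le h0 hxy h1

/-- The descent rate is bounded below in the window, so Y is injective there with a Lipschitz
inverse; this inverse is the layer curve. -/
theorem abs_sub_ge (h : HalfOrbit ψ b ε Y q r) {x y : ℝ} (hx : x ∈ Icc q r) (hy : y ∈ Icc q r) :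
    1 / 4000 * |y - x| ≤ |Y y - Y x| := by
  have hq := h.le_q
  have hr := h.r_le
  rcases le_total x y with hxy | hxy
  · have := h.sub_le (hq.trans hx.1) hxy (hy.2.trans hr)
    rw [abs_of_nonneg (by linarith : 0 ≤ y - x)]
    linarith [neg_abs_le (Y y - Y x)]
  · have := h.sub_le (hq.trans hy.1) hxy (hx.2.trans hr)
    rw [abs_of_nonpos (by linarith : y - x ≤ 0)]
    linarith [le_abs_self (Y y - Y x)]

theorem r_sub_q_le (h : HalfOrbit ψ b ε Y q r) : r - q ≤ 8000 * ε := by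
  have := h.sub_le h.le_q h.q_le_r h.r_le
  rw [h.at_q, h.at_r] at this
  linarith

theorem abs_damping_mul_le (h : HalfOrbit ψ b ε Y q r) {v : ℝ} (hv : |v| ≤ 1) :
    |b * ε * v| ≤ 1 / 10 ^ 30 := by
  have h1 := h.eps_pos
  have h2 := h.eps_le
  have h3 := h.abs_damping_le
  rw [abs_mul, abs_mul, abs_of_pos h1]
  calc |b| * ε * |v| ≤ 1 / 10 ^ 30 * 1 * 1 := by
        gcongr
        exact h2.trans (by norm_num)
    _ = _ := by ring

/-- Bounds for the speed `f_L + b ε v` in the layer. -/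
theorem speed_mem (h : HalfOrbit ψ b ε Y q r) {x v : ℝ} (hx : x ∈ Icc q r) (hv : |v| ≤ 1) :
    forcing x (ψ v) + b * ε * v ∈ Icc (1 / 4000 : ℝ) 2 := by
  have h1 := le_forcing (h.le_q.trans hx.1) (hx.2.trans h.r_le) (h.transition.abs_le_one v)
  have h2 := (_root_.abs_le.1 (abs_forcing_le_one x (h.transition.abs_le_one v))).2
  have h3 := _root_.abs_le.1 (h.abs_damping_mul_le hv)
  norm_num at h3
  constructor <;> linarith [h3.1, h3.2]

theorem exists_layerCurve (h : HalfOrbit ψ b ε Y q r) : ∃ X, LayerCurve ψ b ε q r Y X := by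
  have hε := h.eps_pos
  have hivt : ∀ v ∈ Icc (-1 : ℝ) 1, ∃ x ∈ Icc q r, Y x = ε * v := by
    intro v hv
    have := intermediate_value_Icc' (f := Y) h.q_le_r h.sol.continuous.continuousOn
    rw [h.at_q, h.at_r] at this
    exact this ⟨by nlinarith [hv.1], by nlinarith [hv.2]⟩
  choose! X hX hXY using hivt
  have hlip : ∀ v ∈ Icc (-1 : ℝ) 1, ∀ w ∈ Icc (-1 : ℝ) 1, |X w - X v| ≤ 4000 * ε * |w - v| := by
    intro v hv w hw
    have := h.abs_sub_ge (hX v hv) (hX w hw)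
    rw [hXY v hv, hXY w hw, ← mul_sub, abs_mul, abs_of_pos hε] at this
    linarith
  have hinj : ∀ x ∈ Icc q r, ∀ y ∈ Icc q r, Y x = Y y → x = y := by
    intro x hx y hy hxy
    have := h.abs_sub_ge hy hx
    rw [hxy, sub_self, abs_zero] at this
    have h0 := abs_nonneg (x - y)
    exact sub_eq_zero.1 (abs_eq_zero.1 (by linarith))
  have hcont : ContinuousOn X (Icc (-1) 1) := by
    have : LipschitzOnWith ⟨4000 * ε, by positivity⟩ X (Icc (-1) 1) :=
      LipschitzOnWith.of_dist_le_mul fun w hw v hv => hlip v hv w hw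
    exact this.continuousOn
  have m1 : (1 : ℝ) ∈ Icc (-1 : ℝ) 1 := by norm_num
  have m2 : (-1 : ℝ) ∈ Icc (-1 : ℝ) 1 := by norm_num
  refine ⟨X, hX, hXY, ?_, ?_, hcont, fun v hv => ?_⟩
  · exact hinj _ (hX 1 m1) _ ⟨le_rfl, h.q_le_r⟩ (by rw [hXY 1 m1, h.at_q, mul_one])
  · exact hinj _ (hX (-1) m2) _ ⟨h.q_le_r, le_rfl⟩ (by rw [hXY (-1) m2, h.at_r]; ring)
  · have hv' := Ioo_subset_Icc_self hv
    have hs := h.speed_mem (hX v hv') (_root_.abs_le.2 hv')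
    have hd : HasDerivAt (fun x => Y x / ε)
        ((-(b * Y (X v)) - forcing (X v) (ψ (Y (X v) / ε))) / ε) (X v) :=
      (h.sol (X v)).div_const ε
    rw [hXY v hv', mul_div_cancel_left₀ _ hε.ne'] at hd
    have := HasDerivAt.of_local_left_inverse
      ((hcont v hv').continuousAt (Icc_mem_nhds hv.1 hv.2)) hd
      (by
        have : -(b * (ε * v)) - forcing (X v) (ψ v) = -(forcing (X v) (ψ v) + b * ε * v) := by ring
        rw [this]
        exact div_ne_zero (by linarith [hs.1]) hε.ne') (by
        filter_upwards [Icc_mem_nhds hv.1 hv.2] with w hw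
        rw [hXY w hw, mul_div_cancel_left₀ _ hε.ne'])
    refine this.congr_deriv ?_
    have : -(b * (ε * v)) - forcing (X v) (ψ v) = -(forcing (X v) (ψ v) + b * ε * v) := by ring
    rw [this, inv_div, div_neg]

end HalfOrbit

theorem abs_div_sub_div_le {d₁ d₂ : ℝ} (h1 : 1 / 4000 ≤ d₁) (h2 : 1 / 4000 ≤ d₂) {ε : ℝ}
    (hε : 0 < ε) : |-(ε / d₂) - -(ε / d₁)| ≤ 16 * 10 ^ 6 * ε * |d₂ - d₁| := by
  have p1 : 0 < d₁ := by linarith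
  have p2 : 0 < d₂ := by linarith
  have e : -(ε / d₂) - -(ε / d₁) = ε * (d₂ - d₁) * (1 / (d₁ * d₂)) := by
    field_simp; ring
  rw [e, abs_mul, abs_mul, abs_of_pos hε, abs_of_pos (by positivity : 0 < 1 / (d₁ * d₂))]
  have h3 : 1 / (d₁ * d₂) ≤ 16 * 10 ^ 6 := by
    rw [div_le_iff₀ (by positivity)]
    nlinarith [mul_le_mul h1 h2 (by norm_num) p1.le]
  have := mul_le_mul_of_nonneg_left h3 (by positivity : 0 ≤ ε * |d₂ - d₁|)
  linarith

/-- Two layer curves which start close to each other, for close damping constants, keep their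
distance up to a small error. -/
theorem abs_layer_sub_sub_le {ψ : ℝ → ℝ} {b₁ b₂ ε q₁ r₁ q₂ r₂ : ℝ} {Y₁ Y₂ X₁ X₂ : ℝ → ℝ}
    (h₁ : HalfOrbit ψ b₁ ε Y₁ q₁ r₁) (h₂ : HalfOrbit ψ b₂ ε Y₂ q₂ r₂)
    (l₁ : LayerCurve ψ b₁ ε q₁ r₁ Y₁ X₁) (l₂ : LayerCurve ψ b₂ ε q₂ r₂ Y₂ X₂) {v : ℝ}
    (hv : v ∈ Icc (-1 : ℝ) 1) :
    |(X₂ v - X₁ v) - (q₂ - q₁)| ≤ 10 ^ 9 * ε * (|q₂ - q₁| + |b₂ - b₁|) := by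
  have hε := h₁.eps_pos
  have hε1 : ε ≤ 1 / 10 ^ 10 := h₁.eps_le.trans (by norm_num)
  have hψ := h₁.transition
  have hcont : ContinuousOn (fun v => X₂ v - X₁ v) (Icc (-1) 1) :=
    l₂.continuousOn.sub l₁.continuousOn
  -- The maximal gap S replaces a Gronwall argument: the mean value theorem bounds the drift of the
  -- gap by a multiple of ε(S + |b₂ - b₁|), and ε is small enough to absorb S.
  obtain ⟨m, hm, hmax⟩ := isCompact_Icc.exists_isMaxOn (nonempty_Icc.2 (by norm_num : (-1 : ℝ) ≤ 1))
    hcont.abs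
  set S := |X₂ m - X₁ m| with hS
  have hSmax : ∀ w ∈ Icc (-1 : ℝ) 1, |X₂ w - X₁ w| ≤ S := fun w hw => hmax hw
  have hder : ∀ w ∈ Ioo (-1 : ℝ) 1, |-(ε / (forcing (X₂ w) (ψ w) + b₂ * ε * w)) -
      -(ε / (forcing (X₁ w) (ψ w) + b₁ * ε * w))| ≤ 10 ^ 8 * ε * (S + |b₂ - b₁|) := by
    intro w hw
    have hw' := Ioo_subset_Icc_self hw
    have hwa := abs_le.2 hw'
    have s1 := h₁.speed_mem (l₁.mem w hw') hwa
    have s2 := h₂.speed_mem (l₂.mem w hw') hwa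
    refine (abs_div_sub_div_le s1.1 s2.1 hε).trans ?_
    have e : forcing (X₂ w) (ψ w) + b₂ * ε * w - (forcing (X₁ w) (ψ w) + b₁ * ε * w) =
        (forcing (X₂ w) (ψ w) - forcing (X₁ w) (ψ w)) + (b₂ - b₁) * (ε * w) := by ring
    have h3 := abs_forcing_sub_forcing_le (X₂ w) (X₁ w) (hψ.abs_le_one w)
    have h4 := hSmax w hw'
    have h5 : |(b₂ - b₁) * (ε * w)| ≤ |b₂ - b₁| := by
      rw [abs_mul, abs_mul, abs_of_pos hε]
      have : ε * |w| ≤ 1 := by nlinarith [abs_nonneg w]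
      nlinarith [abs_nonneg (b₂ - b₁)]
    have h6 : |forcing (X₂ w) (ψ w) + b₂ * ε * w - (forcing (X₁ w) (ψ w) + b₁ * ε * w)| ≤
        5 * (S + |b₂ - b₁|) := by
      rw [e]
      refine (abs_add_le _ _).trans ?_
      linarith [abs_nonneg (b₂ - b₁)]
    have := mul_le_mul_of_nonneg_left h6 (by positivity : 0 ≤ 16 * 10 ^ 6 * ε)
    have hSn : 0 ≤ ε * (S + |b₂ - b₁|) := by positivity
    nlinarith
  have hmain : ∀ w ∈ Icc (-1 : ℝ) 1,
      |(X₂ w - X₁ w) - (q₂ - q₁)| ≤ 2 * 10 ^ 8 * ε * (S + |b₂ - b₁|) := by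
    intro w hw
    have hSn : 0 ≤ ε * (S + |b₂ - b₁|) := by positivity
    rcases hw.2.eq_or_lt with rfl | hlt
    · rw [l₂.one, l₁.one, sub_self, abs_zero]; nlinarith
    obtain ⟨z, hz, hslope⟩ := exists_hasDerivAt_eq_slope (fun v => X₂ v - X₁ v) _ hlt
      (hcont.mono (Icc_subset_Icc hw.1 le_rfl))
      (fun z hz => (l₂.hasDerivAt z ⟨by linarith [hw.1, hz.1], hz.2⟩).sub
        (l₁.hasDerivAt z ⟨by linarith [hw.1, hz.1], hz.2⟩))
    have h3 := hder z ⟨by linarith [hw.1, hz.1], hz.2⟩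
    rw [hslope, l₂.one, l₁.one, abs_div, abs_of_pos (by linarith : 0 < 1 - w),
      div_le_iff₀ (by linarith)] at h3
    rw [abs_sub_comm]
    refine h3.trans ?_
    nlinarith [hw.1]
  have hSle : S ≤ 2 * |q₂ - q₁| + |b₂ - b₁| := by
    have h1 := hmain m hm
    have h2 := abs_sub_abs_le_abs_sub (X₂ m - X₁ m) (q₂ - q₁)
    have h3 : 2 * 10 ^ 8 * ε * (S + |b₂ - b₁|) ≤ 1 / 2 * (S + |b₂ - b₁|) :=
      mul_le_mul_of_nonneg_right (by norm_num at hε1 ⊢; linarith) (by positivity)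
    linarith
  refine (hmain v hv).trans ?_
  have := abs_nonneg (q₂ - q₁)
  have := abs_nonneg (b₂ - b₁)
  nlinarith [mul_le_mul_of_nonneg_left hSle hε.le]

/-- Orbits decrease in the window, so the higher one reaches a given level later. -/
theorem layer_lt_of_lt {ψ : ℝ → ℝ} {b ε q₁ r₁ q₂ r₂ : ℝ} {Y₁ Y₂ X₁ X₂ : ℝ → ℝ}
    (h₁ : HalfOrbit ψ b ε Y₁ q₁ r₁) (h₂ : HalfOrbit ψ b ε Y₂ q₂ r₂)
    (l₁ : LayerCurve ψ b ε q₁ r₁ Y₁ X₁) (l₂ : LayerCurve ψ b ε q₂ r₂ Y₂ X₂)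
    (hlt : ∀ x, Y₁ x < Y₂ x) {v : ℝ} (hv : v ∈ Icc (-1 : ℝ) 1) : X₁ v < X₂ v := by
  by_contra hcon
  have hcon := not_lt.1 hcon
  have m1 := l₁.mem v hv
  have m2 := l₂.mem v hv
  have h := h₂.sub_le (h₂.le_q.trans m2.1) hcon (m1.2.trans h₁.r_le)
  have := hlt (X₁ v)
  rw [l₁.comp v hv] at this
  rw [l₂.comp v hv] at h
  linarith

theorem abs_div_mul_sub_div_mul_le {A B d₁ d₂ e₁ e₂ : ℝ} (hd₁ : d₁ ∈ Icc (1 / 4000 : ℝ) 2)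
    (hd₂ : d₂ ∈ Icc (1 / 4000 : ℝ) 2) (he₁ : e₁ ∈ Icc (1 / 4000 : ℝ) 2)
    (he₂ : e₂ ∈ Icc (1 / 4000 : ℝ) 2) (hB : |B| ≤ 5) :
    |A / (d₁ * d₂) - B / (e₁ * e₂)| ≤
      16 * 10 ^ 6 * |A - B| + 10 ^ 16 * (|d₁ - e₁| + |d₂ - e₂|) := by
  have p1 : 0 < d₁ := by linarith [hd₁.1]
  have p2 : 0 < d₂ := by linarith [hd₂.1]
  have p3 : 0 < e₁ := by linarith [he₁.1]
  have p4 : 0 < e₂ := by linarith [he₂.1]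
  have e : A / (d₁ * d₂) - B / (e₁ * e₂) = (A - B) * (1 / (d₁ * d₂)) +
      B * ((e₁ - d₁) * e₂ + d₁ * (e₂ - d₂)) * (1 / (d₁ * d₂) * (1 / (e₁ * e₂))) := by
    field_simp; ring
  have i1 : 1 / (d₁ * d₂) ≤ 16 * 10 ^ 6 := by
    rw [div_le_iff₀ (by positivity)]
    nlinarith [mul_le_mul hd₁.1 hd₂.1 (by norm_num) p1.le]
  have i2 : 1 / (e₁ * e₂) ≤ 16 * 10 ^ 6 := by
    rw [div_le_iff₀ (by positivity)]
    nlinarith [mul_le_mul he₁.1 he₂.1 (by norm_num) p3.le]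
  have i3 : 1 / (d₁ * d₂) * (1 / (e₁ * e₂)) ≤ 16 * 10 ^ 6 * (16 * 10 ^ 6) :=
    mul_le_mul i1 i2 (by positivity) (by norm_num)
  have i4 : |(e₁ - d₁) * e₂ + d₁ * (e₂ - d₂)| ≤ 2 * (|d₁ - e₁| + |d₂ - e₂|) := by
    refine (abs_add_le _ _).trans ?_
    rw [abs_mul, abs_mul, abs_of_pos p4, abs_of_pos p1, abs_sub_comm e₁, abs_sub_comm e₂]
    nlinarith [abs_nonneg (d₁ - e₁), abs_nonneg (d₂ - e₂), he₂.2, hd₁.2]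
  rw [e]
  refine (abs_add_le _ _).trans ?_
  rw [abs_mul, abs_mul (B * _), abs_mul B, abs_of_pos (by positivity : 0 < 1 / (d₁ * d₂)),
    abs_of_pos (by positivity : 0 < 1 / (d₁ * d₂) * (1 / (e₁ * e₂)))]
  have j1 := mul_le_mul_of_nonneg_left i1 (abs_nonneg (A - B))
  have j2 : |B| * |(e₁ - d₁) * e₂ + d₁ * (e₂ - d₂)| ≤ 5 * (2 * (|d₁ - e₁| + |d₂ - e₂|)) :=
    mul_le_mul hB i4 (abs_nonneg _) (by norm_num)
  have j3 := mul_le_mul j2 i3 (by positivity) (by positivity)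
  have := abs_nonneg (d₁ - e₁)
  have := abs_nonneg (d₂ - e₂)
  nlinarith

theorem exists_forcing_slope (l : ℝ) {x y : ℝ} (h : x < y) :
    ∃ z ∈ Ioo x y, forcing y l - forcing x l = forcingDeriv z l * (y - x) := by
  obtain ⟨z, hz, hs⟩ := exists_hasDerivAt_eq_slope (fun x => forcing x l) _ h
    (continuous_forcing l).continuousOn (fun z _ => hasDerivAt_forcing z l)
  refine ⟨z, hz, ?_⟩
  rw [hs, div_mul_cancel₀ _ (by linarith)]

/-- Relative rate of separation of two neighbouring layer curves. -/
theorem exists_separation_rate {ψ : ℝ → ℝ} {b ε q₁ r₁ q₂ r₂ : ℝ} {Y₁ Y₂ X₁ X₂ : ℝ → ℝ}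
    (h₁ : HalfOrbit ψ b ε Y₁ q₁ r₁) (h₂ : HalfOrbit ψ b ε Y₂ q₂ r₂)
    (l₁ : LayerCurve ψ b ε q₁ r₁ Y₁ X₁) (l₂ : LayerCurve ψ b ε q₂ r₂ Y₂ X₂)
    (hlt : ∀ x, Y₁ x < Y₂ x) {v : ℝ} (hv : v ∈ Ioo (-1 : ℝ) 1) :
    ∃ z ∈ Ioo (X₁ v) (X₂ v), HasDerivAt (fun v => log (X₂ v - X₁ v))
      (ε * (forcingDeriv z (ψ v) / ((forcing (X₁ v) (ψ v) + b * ε * v) *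
        (forcing (X₂ v) (ψ v) + b * ε * v)))) v := by
  have hv' := Ioo_subset_Icc_self hv
  have hva := abs_le.2 hv'
  have hX := layer_lt_of_lt h₁ h₂ l₁ l₂ hlt hv'
  obtain ⟨z, hz, hs⟩ := exists_forcing_slope (ψ v) hX
  refine ⟨z, hz, ?_⟩
  have hd := ((l₂.hasDerivAt v hv).sub (l₁.hasDerivAt v hv)).log (sub_pos.2 hX).ne'
  refine hd.congr_deriv ?_
  have s1 := (h₁.speed_mem (l₁.mem v hv') hva).1
  have s2 := (h₂.speed_mem (l₂.mem v hv') hva).1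
  have hne : X₂ v - X₁ v ≠ 0 := (sub_pos.2 hX).ne'
  have p1 : forcing (X₁ v) (ψ v) + b * ε * v ≠ 0 := by linarith
  have p2 : forcing (X₂ v) (ψ v) + b * ε * v ≠ 0 := by linarith
  simp only [Pi.sub_apply]
  rw [div_eq_iff hne, mul_div_assoc', div_mul_eq_mul_div, eq_div_iff (mul_ne_zero p1 p2)]
  have e : ε * (forcingDeriv z (ψ v)) * (X₂ v - X₁ v) =
      ε * ((forcing (X₂ v) (ψ v) + b * ε * v) - (forcing (X₁ v) (ψ v) + b * ε * v)) := by
    rw [add_sub_add_right_eq_sub, hs]; ring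
  rw [e]
  generalize forcing (X₁ v) (ψ v) + b * ε * v = d₁ at *
  generalize forcing (X₂ v) (ψ v) + b * ε * v = d₂ at *
  field_simp
  ring

/-- The separations of two pairs of layer curves change by nearly the same factor. -/
theorem abs_log_separation_sub_le {ψ : ℝ → ℝ} {b c ε q₁ r₁ q₂ r₂ s₁ t₁ s₂ t₂ D : ℝ}
    {Y₁ Y₂ X₁ X₂ Z₁ Z₂ V₁ V₂ : ℝ → ℝ}
    (h₁ : HalfOrbit ψ b ε Y₁ q₁ r₁) (h₂ : HalfOrbit ψ b ε Y₂ q₂ r₂)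
    (k₁ : HalfOrbit ψ c ε Z₁ s₁ t₁) (k₂ : HalfOrbit ψ c ε Z₂ s₂ t₂)
    (l₁ : LayerCurve ψ b ε q₁ r₁ Y₁ X₁) (l₂ : LayerCurve ψ b ε q₂ r₂ Y₂ X₂)
    (m₁ : LayerCurve ψ c ε s₁ t₁ Z₁ V₁) (m₂ : LayerCurve ψ c ε s₂ t₂ Z₂ V₂)
    (hlt : ∀ x, Y₁ x < Y₂ x) (hlt' : ∀ x, Z₁ x < Z₂ x)
    (hD : ∀ v ∈ Icc (-1 : ℝ) 1, |X₁ v - V₁ v| ≤ D ∧ |X₂ v - V₂ v| ≤ D ∧ X₂ v - X₁ v ≤ D) :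
    |(log (r₂ - r₁) - log (t₂ - t₁)) - (log (q₂ - q₁) - log (s₂ - s₁))| ≤
      10 ^ 18 * ε * (D + |b - c|) := by
  have hε := h₁.eps_pos
  have hε1 : ε ≤ 1 := h₁.eps_le.trans (by norm_num)
  have hψ := h₁.transition
  have hc : ContinuousOn (fun v => log (X₂ v - X₁ v) - log (V₂ v - V₁ v)) (Icc (-1) 1) :=
    ((l₂.continuousOn.sub l₁.continuousOn).log
      (fun v hv => (sub_pos.2 (layer_lt_of_lt h₁ h₂ l₁ l₂ hlt hv)).ne')).sub
    ((m₂.continuousOn.sub m₁.continuousOn).log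
      (fun v hv => (sub_pos.2 (layer_lt_of_lt k₁ k₂ m₁ m₂ hlt' hv)).ne'))
  have hder : ∀ v ∈ Ioo (-1 : ℝ) 1, ∃ κ, |κ| ≤ 5 * 10 ^ 17 * ε * (D + |b - c|) ∧
      HasDerivAt (fun v => log (X₂ v - X₁ v) - log (V₂ v - V₁ v)) κ v := by
    intro v hv
    have hv' := Ioo_subset_Icc_self hv
    have hva := abs_le.2 hv'
    obtain ⟨z, hz, hdz⟩ := exists_separation_rate h₁ h₂ l₁ l₂ hlt hv
    obtain ⟨w, hw, hdw⟩ := exists_separation_rate k₁ k₂ m₁ m₂ hlt' hv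
    refine ⟨_, ?_, hdz.sub hdw⟩
    obtain ⟨d1, d2, d3⟩ := hD v hv'
    have hD0 : 0 ≤ D := (abs_nonneg _).trans d1
    rw [← mul_sub, abs_mul, abs_of_pos hε]
    have key := abs_div_mul_sub_div_mul_le (A := forcingDeriv z (ψ v)) (B := forcingDeriv w (ψ v))
      (h₁.speed_mem (l₁.mem v hv') hva) (h₂.speed_mem (l₂.mem v hv') hva)
      (k₁.speed_mem (m₁.mem v hv') hva) (k₂.speed_mem (m₂.mem v hv') hva)
      (abs_forcingDeriv_le w (hψ.abs_le_one v))
    have hzw : |z - w| ≤ 2 * D := by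
      have e1 := abs_le.1 d1
      have e2 := abs_le.1 d2
      rw [abs_le]
      constructor <;> linarith [hz.1, hz.2, hw.1, hw.2]
    have a1 := abs_forcingDeriv_sub_le z w (hψ.abs_le_one v)
    have hsp : ∀ x y : ℝ, |x - y| ≤ D → |forcing x (ψ v) + b * ε * v -
        (forcing y (ψ v) + c * ε * v)| ≤ 5 * D + |b - c| := by
      intro x y hxy
      have e : forcing x (ψ v) + b * ε * v - (forcing y (ψ v) + c * ε * v) =
        (forcing x (ψ v) - forcing y (ψ v)) + (b - c) * (ε * v) := by ring
      rw [e]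
      refine (abs_add_le _ _).trans ?_
      have f1 := abs_forcing_sub_forcing_le x y (hψ.abs_le_one v)
      have f2 : |(b - c) * (ε * v)| ≤ |b - c| := by
        rw [abs_mul, abs_mul, abs_of_pos hε]
        have : ε * |v| ≤ 1 := by nlinarith [abs_nonneg v]
        nlinarith [abs_nonneg (b - c)]
      linarith
    have a2 := hsp _ _ d1
    have a3 := hsp _ _ d2
    have hn := abs_nonneg (b - c)
    have : ε * |forcingDeriv z (ψ v) / ((forcing (X₁ v) (ψ v) + b * ε * v) *
        (forcing (X₂ v) (ψ v) + b * ε * v)) - forcingDeriv w (ψ v) /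
        ((forcing (V₁ v) (ψ v) + c * ε * v) * (forcing (V₂ v) (ψ v) + c * ε * v))| ≤
        ε * (5 * 10 ^ 17 * (D + |b - c|)) := by
      refine mul_le_mul_of_nonneg_left (key.trans ?_) hε.le
      linarith
    linarith
  choose! κ hκ hκd using hder
  -- The factor ε in each logarithmic rate multiplies a difference of rates that is itself O(D + |b
  -- - c|); v runs over an interval of length 2.
  obtain ⟨z, hz, hs⟩ := exists_hasDerivAt_eq_slope _ κ (by norm_num : (-1 : ℝ) < 1) hc
    (fun v hv => hκd v hv)
  have := hκ z hz
  rw [hs, abs_div, div_le_iff₀ (by norm_num), l₁.one, l₂.one, m₁.one, m₂.one, l₁.neg_one,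
    l₂.neg_one, m₁.neg_one, m₂.neg_one, abs_sub_comm] at this
  refine this.trans (le_of_eq ?_)
  norm_num
  ring

/-! ### Damped and reversed half-orbits from the same initial value. -/

namespace HalfOrbit

variable {ψ : ℝ → ℝ} {b ε : ℝ} {Y : ℝ → ℝ} {q r : ℝ}

theorem field_upper (h : HalfOrbit ψ b ε Y q r) {x : ℝ} (hx : x ∈ Icc 0 q) :
    -(b * Y x) - forcing x (ψ (Y x / ε)) = -(b * Y x) - sin (3 * π * x / 2) := by
  rw [h.transition.eq_one (Y x / ε) (by rw [le_div_iff₀ h.eps_pos]; linarith [h.upper x hx]),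
    forcing_one]

theorem field_lower (h : HalfOrbit ψ b ε Y q r) {x : ℝ} (hx : x ∈ Icc r 2) :
    -(b * Y x) - forcing x (ψ (Y x / ε)) = -(b * Y x) - sin (π * x / 2) := by
  rw [h.transition.eq_neg_one (Y x / ε) (by rw [div_le_iff₀ h.eps_pos]; linarith [h.lower x hx]),
    forcing_neg_one]

theorem abs_sub_upper_le (h : HalfOrbit ψ b ε Y q r) {x : ℝ} (hx : x ∈ Icc 0 q) :
    |Y x - (Y 0 + 2 / (3 * π) * (cos (3 * π * x / 2) - 1))| ≤ 6 * |b| :=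
  h.sol.abs_sub_upper_le h.transition h.eps_pos h.abs_le (by linarith [h.q_le]) h.upper hx

theorem lower_le (h : HalfOrbit ψ b ε Y q r) {x : ℝ} (hx : x ∈ Icc r 2) :
    Y x ≤ 2 / π * (cos (π * x / 2) - cos (π * r / 2)) + 6 * |b| := by
  have hd : ∀ z, HasDerivAt (fun z => Y z - 2 / π * cos (π * z / 2))
      (-(b * Y z) - forcing z (ψ (Y z / ε)) - -sin (π * z / 2)) z :=
    fun z => (h.sol z).sub (hasDerivAt_cos_half z)
  have hr := h.le_q.trans h.q_le_r
  have h1 := image_sub_le_of_hasDerivAt hx.1 hd (C := 3 * |b|) (fun z hz => by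
    rw [h.field_lower ⟨hz.1, hz.2.trans hx.2⟩]
    have := h.abs_le z ⟨by linarith [hz.1], hz.2.trans hx.2⟩
    have h4 := neg_abs_le (b * Y z)
    rw [abs_mul] at h4
    nlinarith [abs_nonneg b])
  have := h.eps_pos
  simp only [h.at_r] at h1
  nlinarith [hx.1, hx.2, abs_nonneg b]

/-- The undamped orbit from this height reaches y = 0 exactly at 2/3 - 1/2000; damping and ε are far
too small to advance the entry by 1/6000. -/
theorem le_entry_of_high (h : HalfOrbit ψ b ε Y q r)
    (hc : Y 0 = 2 / (3 * π) * (1 - cos (3 * π * (2 / 3 - 1 / 2000) / 2))) :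
    2 / 3 - 1 / 1500 ≤ q := by
  have hε2 : ε ≤ 1 / 10 ^ 20 := h.eps_le.trans (by norm_num)
  have hb2 : |b| ≤ 1 / 10 ^ 20 := h.abs_damping_le.trans (by norm_num)
  norm_num at hε2 hb2
  have hk1 : 1 / 6 ≤ 2 / (3 * π) := by
    rw [le_div_iff₀ (by positivity)]; linarith [pi_le_four]
  have hq3 := h.le_q
  by_contra hcon
  have hcon := not_le.1 hcon
  have h1 := (_root_.abs_le.1 (h.abs_sub_upper_le (x := q) ⟨by linarith, le_rfl⟩)).1
  rw [h.at_q, hc] at h1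
  have h2 : cos (3 * π * (2 / 3 - 1 / 1500) / 2) ≤ cos (3 * π * q / 2) := by
    apply cos_le_cos_of_nonneg_of_le_pi
    · positivity
    · nlinarith [pi_pos]
    · nlinarith [pi_pos]
  have h3 := cos_three_half_sub_ge (x := 2 / 3 - 1 / 1500) (y := 2 / 3 - 1 / 2000) (by norm_num)
    (by norm_num) (by norm_num)
  generalize cos (3 * π * (2 / 3 - 1 / 1500) / 2) = A at *
  generalize cos (3 * π * (2 / 3 - 1 / 2000) / 2) = B at *
  norm_num at h3
  nlinarith

/-- The undamped orbit is (2/(3π)) cos(3πx/2), with zero at x = 1/3. -/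
theorem entry_le_of_low (h : HalfOrbit ψ b ε Y q r) (hc : Y 0 = 2 / (3 * π)) :
    q ≤ 35 / 100 := by
  have hε := h.eps_pos
  have hb2 : |b| ≤ 1 / 10 ^ 20 := h.abs_damping_le.trans (by norm_num)
  norm_num at hb2
  have hk1 : 1 / 6 ≤ 2 / (3 * π) := by
    rw [le_div_iff₀ (by positivity)]; linarith [pi_le_four]
  by_contra hcon
  have hcon := not_le.1 hcon
  have h1 := (_root_.abs_le.1 (h.abs_sub_upper_le (x := q) ⟨by linarith, le_rfl⟩)).2
  rw [h.at_q, hc] at h1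
  have h2 : cos (3 * π * q / 2) ≤ cos (3 * π * (35 / 100) / 2) := by
    apply cos_le_cos_of_nonneg_of_le_pi
    · positivity
    · nlinarith [h.q_le, pi_pos]
    · nlinarith [pi_pos]
  have h3 := two_mul_le_sin_pi_mul (t := 25 / 1000) (by norm_num) (by norm_num)
  have h4 : cos (3 * π * (35 / 100) / 2) = -sin (π * (25 / 1000)) := by
    rw [show 3 * π * (35 / 100) / 2 = π * (25 / 1000) + π / 2 by ring, cos_add_pi_div_two]
  nlinarith

theorem le_neg_of_one_le (h : HalfOrbit ψ b ε Y q r) (hr : r ≤ 4 / 10) {x : ℝ}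
    (hx : x ∈ Icc (1 : ℝ) 2) : Y x ≤ -(3 / 10) := by
  have hb2 : |b| ≤ 1 / 10 ^ 20 := h.abs_damping_le.trans (by norm_num)
  norm_num at hb2
  have hk3 : 6 / 10 ≤ 2 / π := by
    rw [le_div_iff₀ (by positivity)]; linarith [pi_lt_d2]
  have h1 := h.lower_le (x := x) ⟨by linarith [hx.1], hx.2⟩
  have h2 : cos (π * x / 2) ≤ 0 := by
    apply cos_nonpos_of_pi_div_two_le_of_le
    · nlinarith [hx.1, pi_pos]
    · nlinarith [hx.2, pi_pos]
  have h3 := le_sin_half (x := 1 - r) (by linarith) (by linarith [h.le_q, h.q_le_r])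
  rw [show π * (1 - r) / 2 = π / 2 - π * r / 2 by ring, sin_pi_div_two_sub] at h3
  nlinarith

end HalfOrbit

section Comparison

variable {ψ : ℝ → ℝ} {a ε q r q' r' : ℝ} {Y Z : ℝ → ℝ}

theorem hasDerivAt_sub_sol (hY : HalfOrbit ψ a ε Y q r) (hZ : HalfOrbit ψ (-a) ε Z q' r') (x : ℝ) :
    HasDerivAt (fun x => Z x - Y x) ((-(-a * Z x) - forcing x (ψ (Z x / ε))) -
      (-(a * Y x) - forcing x (ψ (Y x / ε)))) x :=
  (hZ.sol x).sub (hY.sol x)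

/-- On a common side of the layer the forcing is independent of y and cancels, so only the damping
separates the two orbits. -/
theorem deriv_sub_upper (hY : HalfOrbit ψ a ε Y q r) (hZ : HalfOrbit ψ (-a) ε Z q' r') {x : ℝ}
    (hx : x ∈ Icc 0 q) (hx' : x ∈ Icc 0 q') :
    (-(-a * Z x) - forcing x (ψ (Z x / ε))) - (-(a * Y x) - forcing x (ψ (Y x / ε))) =
      a * (Z x + Y x) := by
  rw [hY.field_upper hx, hZ.field_upper hx']; ring

theorem deriv_sub_lower (hY : HalfOrbit ψ a ε Y q r) (hZ : HalfOrbit ψ (-a) ε Z q' r') {x : ℝ}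
    (hx : x ∈ Icc r 2) (hx' : x ∈ Icc r' 2) :
    (-(-a * Z x) - forcing x (ψ (Z x / ε))) - (-(a * Y x) - forcing x (ψ (Y x / ε))) =
      a * (Z x + Y x) := by
  rw [hY.field_lower hx, hZ.field_lower hx']; ring

/-- The damped orbit enters the layer before the one with reversed damping. -/
theorem entry_le_entry (ha : 0 < a) (hY : HalfOrbit ψ a ε Y q r)
    (hZ : HalfOrbit ψ (-a) ε Z q' r') (h0 : Y 0 = Z 0) : q ≤ q' := by
  by_contra hcon
  have hcon := not_le.1 hcon
  have hq' := hZ.le_q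
  have h1 := le_image_sub_of_hasDerivAt (p := 0) (s := q') (C := 0) (by linarith)
    (hasDerivAt_sub_sol hY hZ) (fun x hx => by
      have hx1 : x ∈ Icc 0 q := ⟨hx.1, hx.2.trans hcon.le⟩
      rw [deriv_sub_upper hY hZ hx1 hx]
      have := hY.upper x hx1
      have := hZ.upper x hx
      have := hY.eps_pos
      exact mul_nonneg ha.le (by linarith))
  have h2 := hY.sub_le hq' hcon.le (hY.q_le_r.trans hY.r_le)
  have := hY.at_q
  have := hZ.at_q
  simp only [h0] at h1
  linarith

theorem entry_gap_le (ha : 0 < a) (hY : HalfOrbit ψ a ε Y q r) (hZ : HalfOrbit ψ (-a) ε Z q' r')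
    (h0 : Y 0 = Z 0) {M : ℝ} (hM : ∀ x ∈ Icc 0 q, Z x + Y x ≤ M) : Z q - ε ≤ a * M * q := by
  have hqq := entry_le_entry ha hY hZ h0
  have := hY.le_q
  have h1 := image_sub_le_of_hasDerivAt (p := 0) (s := q) (C := a * M) (by linarith)
    (hasDerivAt_sub_sol hY hZ) (fun x hx => by
      rw [deriv_sub_upper hY hZ hx ⟨hx.1, hx.2.trans hqq⟩]
      exact mul_le_mul_of_nonneg_left (hM x hx) ha.le)
  simp only [h0, hY.at_q] at h1
  linarith

theorem entry_sub_entry_le (ha : 0 < a) (hY : HalfOrbit ψ a ε Y q r)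
    (hZ : HalfOrbit ψ (-a) ε Z q' r') (h0 : Y 0 = Z 0) : q' - q ≤ 20000 * a := by
  have hqq := entry_le_entry ha hY hZ h0
  have h1 := entry_gap_le ha hY hZ h0 (M := 6) (fun x hx => by
    have hx2 : x ∈ Icc (0 : ℝ) 2 := ⟨hx.1, by linarith [hx.2, hY.q_le]⟩
    linarith [(abs_le.1 (hY.abs_le x hx2)).2, (abs_le.1 (hZ.abs_le x hx2)).2])
  have h2 := hZ.sub_le hY.le_q hqq (hZ.q_le_r.trans hZ.r_le)
  rw [hZ.at_q] at h2
  nlinarith [hY.q_le]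

theorem abs_exit_sub_sub_le (hY : HalfOrbit ψ a ε Y q r) (hZ : HalfOrbit ψ (-a) ε Z q' r')
    (ha : 0 < a) : |(r' - r) - (q' - q)| ≤ 10 ^ 9 * ε * (|q' - q| + 2 * a) := by
  obtain ⟨X, hX⟩ := hY.exists_layerCurve
  obtain ⟨V, hV⟩ := hZ.exists_layerCurve
  have := abs_layer_sub_sub_le hY hZ hX hV (v := -1) (by norm_num)
  rw [hX.neg_one, hV.neg_one, show -a - a = -(2 * a) by ring, abs_neg,
    abs_of_pos (by linarith : 0 < 2 * a)] at this
  exact this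

set_option maxHeartbeats 1000000 in
/-- At the upper end of the range of initial values the damped orbit ends below its reversal. -/
theorem end_lt_of_initial_eq_high (ha : 0 < a) (hY : HalfOrbit ψ a ε Y q r)
    (hZ : HalfOrbit ψ (-a) ε Z q' r') (h0 : Y 0 = Z 0)
    (hc : Y 0 = 2 / (3 * π) * (1 - cos (3 * π * (2 / 3 - 1 / 2000) / 2))) : Y 2 < Z 2 := by
  have hε := hY.eps_pos
  have hε2 : ε ≤ 1 / 10 ^ 20 := hY.eps_le.trans (by norm_num)
  have ha2 : a ≤ 1 / 10 ^ 20 := by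
    have := hY.abs_damping_le
    rw [abs_of_pos ha] at this
    exact this.trans (by norm_num)
  norm_num at hε2 ha2
  have hπ3 := pi_gt_d2
  have hπ4 := pi_lt_d2
  have hk1 : 21 / 100 ≤ 2 / (3 * π) := by
    rw [le_div_iff₀ (by positivity)]; linarith
  have hq3 := hY.le_q
  have hqM := hY.q_le
  have hqq := entry_le_entry ha hY hZ h0
  set cH := cos (3 * π * (2 / 3 - 1 / 2000) / 2) with hcH
  have hcH1 : cH ≤ -(99 / 100) := by
    have h1 := one_sub_sq_div_two_le_cos (x := 3 * π / 4000)
    have h2 : cH = -cos (3 * π / 4000) := by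
      rw [hcH, show 3 * π * (2 / 3 - 1 / 2000) / 2 = π - 3 * π / 4000 by ring, cos_pi_sub]
    nlinarith
  have hq := hY.le_entry_of_high hc
  have hYlow : ∀ x ∈ Icc (0 : ℝ) (1 / 3), 1 / 5 ≤ Y x := by
    intro x hx
    have h1 := (abs_le.1 (hY.abs_sub_upper_le (x := x) ⟨hx.1, by linarith [hx.2]⟩)).1
    rw [hc, abs_of_pos ha] at h1
    have h2 : 0 ≤ cos (3 * π * x / 2) := by
      apply cos_nonneg_of_neg_pi_div_two_le_of_le
      · have := hx.1
        have : 0 ≤ 3 * π * x / 2 := by positivity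
        linarith
      · nlinarith [hx.2]
    nlinarith
  -- On the first third Z ≥ Y ≥ 1/5, so the gap reaches at least 2a/15.
  have hD1 := le_image_sub_of_hasDerivAt (p := 0) (s := 1 / 3) (C := 2 / 5 * a) (by norm_num)
    (hasDerivAt_sub_sol hY hZ) (fun x hx => by
      have hx1 : x ∈ Icc 0 q := ⟨hx.1, by linarith [hx.2]⟩
      have hx2 : x ∈ Icc 0 q' := ⟨hx.1, hx1.2.trans hqq⟩
      rw [deriv_sub_upper hY hZ hx1 hx2]
      have h1 := hYlow x hx
      have h2 := le_image_sub_of_hasDerivAt (p := 0) (s := x) (C := 0) hx.1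
        (hasDerivAt_sub_sol hY hZ) (fun z hz => by
          have hz1 : z ∈ Icc 0 q := ⟨hz.1, hz.2.trans hx1.2⟩
          have hz2 : z ∈ Icc 0 q' := ⟨hz.1, hz.2.trans hx2.2⟩
          rw [deriv_sub_upper hY hZ hz1 hz2]
          exact mul_nonneg ha.le (by linarith [hY.upper z hz1, hZ.upper z hz2]))
      simp only [h0] at h2
      nlinarith)
  have hD2 := le_image_sub_of_hasDerivAt (p := 1 / 3) (s := q) (C := 0) (by linarith)
    (hasDerivAt_sub_sol hY hZ) (fun x hx => by
      have hx1 : x ∈ Icc 0 q := ⟨by linarith [hx.1], hx.2⟩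
      have hx2 : x ∈ Icc 0 q' := ⟨hx1.1, hx1.2.trans hqq⟩
      rw [deriv_sub_upper hY hZ hx1 hx2]
      exact mul_nonneg ha.le (by linarith [hY.upper x hx1, hZ.upper x hx2]))
  -- Near tangency Z descends at rate at most 32/10000, so closing a gap of 2a/15 delays its entry
  -- by more than 40a.
  have hD3 := le_image_sub_of_hasDerivAt (p := q) (s := q') (C := -(32 / 10000)) hqq hZ.sol
    (fun x hx => by
      have hx2 : x ∈ Icc 0 q' := ⟨by linarith [hx.1], hx.2⟩
      rw [hZ.field_upper hx2]
      have h1 := hZ.upper x hx2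
      have h2 : sin (3 * π * x / 2) ≤ 3 * π / 2 * (2 / 3 - x) := by
        rw [← sin_pi_sub]
        refine (sin_le ?_).trans (le_of_eq (by ring))
        nlinarith [hx.2, hZ.q_le]
      have h3 : 3 * π / 2 * (2 / 3 - x) ≤ 32 / 10000 := by
        have : 2 / 3 - x ≤ 1 / 1500 := by linarith [hx.1]
        have h5 : 0 ≤ 2 / 3 - x := by linarith [hx.2, hZ.q_le]
        nlinarith
      nlinarith)
  simp only [h0, sub_self, sub_zero] at hD1
  rw [hZ.at_q] at hD3
  rw [hY.at_q] at hD2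
  have hgap : 40 * a ≤ q' - q := by linarith
  have hexit := (abs_le.1 (abs_exit_sub_sub_le hY hZ ha)).1
  rw [abs_of_nonneg (by linarith : 0 ≤ q' - q)] at hexit
  have hrr : 39 * a ≤ r' - r := by
    have : 10 ^ 9 * ε * ((q' - q) + 2 * a) ≤ 1 / 100 * ((q' - q) + 2 * a) :=
      mul_le_mul_of_nonneg_right (by linarith) (by linarith)
    linarith
  have hrq := hY.q_le_r
  have hr'M := hZ.r_le
  -- During a delay of at least 39a the damped orbit falls at rate at least 6/10, opening a gap
  -- above 23a. The damping afterwards takes back at most 6a per unit of phase, hence less than 12a.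
  have hYr' := image_sub_le_of_hasDerivAt (p := r) (s := r') (C := -(6 / 10)) (by linarith) hY.sol
    (fun x hx => by
      rw [hY.field_lower ⟨hx.1, by linarith [hx.2]⟩]
      have h1 := le_sin_half (x := x) (by linarith [hx.1]) (by linarith [hx.2])
      have h2 := (abs_le.1 (hY.abs_le x ⟨by linarith [hx.1], by linarith [hx.2]⟩)).1
      nlinarith [hx.1])
  have hD4 := le_image_sub_of_hasDerivAt (p := r') (s := 2) (C := -(6 * a)) (by linarith)
    (hasDerivAt_sub_sol hY hZ) (fun x hx => by
      rw [deriv_sub_lower hY hZ ⟨by linarith [hx.1], hx.2⟩ hx]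
      have h2 := (abs_le.1 (hY.abs_le x ⟨by linarith [hx.1], hx.2⟩)).1
      have h3 := (abs_le.1 (hZ.abs_le x ⟨by linarith [hx.1], hx.2⟩)).1
      nlinarith)
  rw [hY.at_r] at hYr'
  simp only [hZ.at_r] at hD4
  nlinarith

set_option maxHeartbeats 1000000 in
/-- At the lower end of the range of initial values the damped orbit ends above its reversal. -/
theorem lt_end_of_initial_eq_low (ha : 0 < a) (hY : HalfOrbit ψ a ε Y q r)
    (hZ : HalfOrbit ψ (-a) ε Z q' r') (h0 : Y 0 = Z 0) (hc : Y 0 = 2 / (3 * π)) : Z 2 < Y 2 := by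
  have hε := hY.eps_pos
  have hε2 : ε ≤ 1 / 10 ^ 20 := hY.eps_le.trans (by norm_num)
  have ha2 : a ≤ 1 / 10 ^ 20 := by
    have := hY.abs_damping_le
    rw [abs_of_pos ha] at this
    exact this.trans (by norm_num)
  norm_num at hε2 ha2
  have hπ3 := pi_gt_d2
  have hπ4 := pi_lt_d2
  have hk1 : 21 / 100 ≤ 2 / (3 * π) := by
    rw [le_div_iff₀ (by positivity)]; linarith
  have hk2 : 2 / (3 * π) ≤ 22 / 100 := by
    rw [div_le_iff₀ (by positivity)]; linarith
  have hq3 := hY.le_q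
  have hqq := entry_le_entry ha hY hZ h0
  have hq' := hZ.entry_le_of_low (h0.symm.trans hc)
  have hYup : ∀ x ∈ Icc 0 q, Z x + Y x ≤ 1 / 2 := by
    intro x hx
    have h1 := (abs_le.1 (hY.abs_sub_upper_le hx)).2
    have h2 := (abs_le.1 (hZ.abs_sub_upper_le (x := x) ⟨hx.1, hx.2.trans hqq⟩)).2
    rw [← h0, abs_neg] at h2
    rw [abs_of_pos ha] at h1 h2
    have := cos_le_one (3 * π * x / 2)
    nlinarith
  have hgap := entry_gap_le ha hY hZ h0 hYup
  have hD3 := image_sub_le_of_hasDerivAt (p := q) (s := q') (C := -(89 / 100)) hqq hZ.sol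
    (fun x hx => by
      have hx2 : x ∈ Icc 0 q' := ⟨by linarith [hx.1], hx.2⟩
      rw [hZ.field_upper hx2]
      have h1 := (abs_le.1 (hZ.abs_le x ⟨hx2.1, by linarith [hx.2]⟩)).2
      have h2 : 9 / 10 ≤ sin (3 * π * x / 2) := by
        rw [show 3 * π * x / 2 = π * (3 * x / 2) by ring]
        rcases le_total (3 * x / 2) (1 / 2) with h | h
        · linarith [two_mul_le_sin_pi_mul (t := 3 * x / 2) (by linarith [hx2.1]) h, hx.1]
        · linarith [two_mul_one_sub_le_sin_pi_mul (t := 3 * x / 2) h (by linarith [hx.2]), hx.2]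
      nlinarith)
  rw [hZ.at_q] at hD3
  -- The gap at q is at most (a/2)(35/100), and Z closes it at rate at least 89/100.
  have hqd : q' - q ≤ 1 / 5 * a := by nlinarith
  have hexit := (abs_le.1 (abs_exit_sub_sub_le hY hZ ha)).2
  rw [abs_of_nonneg (by linarith : 0 ≤ q' - q)] at hexit
  have hrr : r' - r ≤ 3 / 10 * a := by
    have : 10 ^ 9 * ε * ((q' - q) + 2 * a) ≤ 1 / 100 * ((q' - q) + 2 * a) :=
      mul_le_mul_of_nonneg_right (by linarith) (by linarith)
    linarith
  have hr := hY.r_sub_q_le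
  have hr' := hZ.r_sub_q_le
  have hrq := hY.q_le_r
  have hrq' := hZ.q_le_r
  -- ρ is the later of the two exits, after which both orbits are below the layer. From there the
  -- gap cannot grow, and over [1, 2] it loses at least 6a/10, so its sign changes.
  obtain ⟨ρ, hρ1, hρ2, hρ3, hρ4⟩ : ∃ ρ, r ≤ ρ ∧ r' ≤ ρ ∧ ρ ≤ 1 ∧ Z ρ - Y ρ ≤ 3 / 10 * a := by
    rcases le_total r r' with h | h
    · refine ⟨r', h, le_rfl, by linarith, ?_⟩
      have := le_image_sub_of_hasDerivAt (p := r) (s := r') (C := -1) h hY.sol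
        (fun x hx => by
          have hx' : x ∈ Icc r 2 := ⟨hx.1, by linarith [hx.2]⟩
          rw [hY.field_lower hx']
          have h1 := sin_le_one (π * x / 2)
          have h2 := hY.lower x hx'
          nlinarith)
      rw [hY.at_r] at this
      rw [hZ.at_r]
      linarith
    · refine ⟨r, le_rfl, h, by linarith, ?_⟩
      have := hZ.lower r ⟨h, by linarith⟩
      rw [hY.at_r]
      linarith
  have hD4 := image_sub_le_of_hasDerivAt (p := ρ) (s := 1) (C := 0) hρ3
    (hasDerivAt_sub_sol hY hZ) (fun x hx => by
      have hx1 : x ∈ Icc r 2 := ⟨hρ1.trans hx.1, by linarith [hx.2]⟩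
      have hx2 : x ∈ Icc r' 2 := ⟨hρ2.trans hx.1, by linarith [hx.2]⟩
      rw [deriv_sub_lower hY hZ hx1 hx2]
      have h2 := hY.lower x hx1
      have h3 := hZ.lower x hx2
      nlinarith)
  have hD5 := image_sub_le_of_hasDerivAt (p := 1) (s := 2) (C := -(6 / 10 * a)) (by norm_num)
    (hasDerivAt_sub_sol hY hZ) (fun x hx => by
      have hx1 : x ∈ Icc r 2 := ⟨by linarith [hx.1], hx.2⟩
      have hx2 : x ∈ Icc r' 2 := ⟨by linarith [hx.1], hx.2⟩
      rw [deriv_sub_lower hY hZ hx1 hx2]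
      have h2 := hY.le_neg_of_one_le (by linarith) hx
      have h3 := hZ.le_neg_of_one_le (by linarith) hx
      nlinarith)
  linarith

end Comparison

/-! ### Separation of neighbouring half-orbits. -/

theorem exp_mul_eq_of_deriv_eq {f f' : ℝ → ℝ} {b p s : ℝ} (hps : p ≤ s)
    (hf : ∀ x, HasDerivAt f (f' x) x) (hb : ∀ x ∈ Icc p s, f' x = -(b * f x)) :
    exp (b * s) * f s = exp (b * p) * f p := by
  have hd : ∀ x, HasDerivAt (fun x => exp (b * x) * f x)
      (exp (b * x) * b * f x + exp (b * x) * f' x) x := fun x => by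
    have h1 : HasDerivAt (fun x => b * x) b x := by
      simpa using (hasDerivAt_id x).const_mul b
    exact h1.exp.mul (hf x)
  have h0 : ∀ x ∈ Icc p s, exp (b * x) * b * f x + exp (b * x) * f' x = 0 := fun x hx => by
    rw [hb x hx]; ring
  have h1 := image_sub_le_of_hasDerivAt hps hd (fun x hx => (h0 x hx).le)
  have h2 := le_image_sub_of_hasDerivAt hps hd (fun x hx => (h0 x hx).ge)
  linarith

/-- Second-order bound near 0. In `log_sin_factor_le` the difference |x - y| is only O(a) with a
large constant; the small factor |x + y| makes the product negligible against a. -/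
theorem abs_cos_sub_cos_le_mul (x y : ℝ) : |cos x - cos y| ≤ |x + y| * |x - y| / 2 := by
  rw [cos_sub_cos, abs_mul, abs_mul, abs_neg, abs_two]
  have h1 : |sin ((x + y) / 2)| ≤ |(x + y) / 2| := abs_sin_le_abs
  have h2 : |sin ((x - y) / 2)| ≤ |(x - y) / 2| := abs_sin_le_abs
  rw [abs_div, abs_two] at h1 h2
  have := mul_le_mul h1 h2 (abs_nonneg _) (by positivity)
  nlinarith

theorem sin_half_le_sin_half {x y : ℝ} (h0 : 0 ≤ x) (hxy : x ≤ y) (h1 : y ≤ 1) :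
    sin (π * x / 2) ≤ sin (π * y / 2) := by
  have := pi_pos
  apply sin_le_sin_of_le_of_le_pi_div_two <;> nlinarith

theorem cos_pi_mul_le_cos_pi_mul {x y : ℝ} (h0 : 0 ≤ x) (hxy : x ≤ y) (h1 : y ≤ 1) :
    cos (π * y) ≤ cos (π * x) := by
  have := pi_pos
  apply cos_le_cos_of_nonneg_of_le_pi <;> nlinarith

theorem le_one_add_two_cos {x : ℝ} (h0 : 3 / 10 ≤ x) (h1 : x ≤ 2 / 3 - 1 / 5000) :
    1 / 2000 ≤ 1 + 2 * cos (π * x) := by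
  have h2 := le_sin_three_half h0 h1
  rw [sin_three_mul_half] at h2
  have h3 := le_sin_half (x := x) (by linarith) (by linarith)
  have h4 := sin_le_one (π * x / 2)
  by_contra hcon
  have hcon := not_le.1 hcon
  nlinarith

theorem log_le_log_add {x y z : ℝ} (hx : 0 < x) (hy : 0 < y) (hz : 0 ≤ z) (h : x ≤ y * (1 + z)) :
    log x ≤ log y + z := by
  have h1 := log_le_log hx h
  rw [log_mul hy.ne' (by linarith)] at h1
  linarith [log_le_sub_one_of_pos (by linarith : 0 < 1 + z)]

namespace HalfOrbit

variable {ψ : ℝ → ℝ} {b ε : ℝ} {Y₁ Y₂ : ℝ → ℝ} {q₁ r₁ q₂ r₂ : ℝ}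

theorem exp_mul_sub_upper (h₁ : HalfOrbit ψ b ε Y₁ q₁ r₁) (h₂ : HalfOrbit ψ b ε Y₂ q₂ r₂)
    (hq : q₁ ≤ q₂) : exp (b * q₁) * (Y₂ q₁ - ε) = Y₂ 0 - Y₁ 0 := by
  have h := exp_mul_eq_of_deriv_eq (p := 0) (s := q₁) (b := b) (f := fun x => Y₂ x - Y₁ x)
    (by linarith [h₁.le_q]) (fun x => (h₂.sol x).sub (h₁.sol x)) (fun x hx => by
      rw [h₁.field_upper hx, h₂.field_upper ⟨hx.1, hx.2.trans hq⟩]; ring)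
  simpa [h₁.at_q] using h

theorem exp_mul_sub_lower (h₁ : HalfOrbit ψ b ε Y₁ q₁ r₁) (h₂ : HalfOrbit ψ b ε Y₂ q₂ r₂)
    (hr : r₁ ≤ r₂) : exp (b * 2) * (Y₂ 2 - Y₁ 2) = exp (b * r₂) * (-ε - Y₁ r₂) := by
  have h := exp_mul_eq_of_deriv_eq (p := r₂) (s := 2) (b := b) (f := fun x => Y₂ x - Y₁ x)
    (by linarith [h₂.r_le]) (fun x => (h₂.sol x).sub (h₁.sol x)) (fun x hx => by
      rw [h₂.field_lower hx, h₁.field_lower ⟨hr.trans hx.1, hx.2⟩]; ring)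
  simpa [h₂.at_r] using h

theorem entry_sub_le (h₁ : HalfOrbit ψ b ε Y₁ q₁ r₁) (h₂ : HalfOrbit ψ b ε Y₂ q₂ r₂)
    (hq : q₁ ≤ q₂) : q₂ - q₁ ≤ 8000 * (Y₂ 0 - Y₁ 0) := by
  have h := h₁.exp_mul_sub_upper h₂ hq
  have h3 := h₂.sub_le h₁.le_q hq (h₂.q_le_r.trans h₂.r_le)
  rw [h₂.at_q] at h3
  have h4 : 1 / 2 ≤ exp (b * q₁) := by
    have h5 := add_one_le_exp (b * q₁)
    have h6 : |b * q₁| ≤ 1 / 2 := by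
      rw [abs_mul, abs_of_pos (by linarith [h₁.le_q] : 0 < q₁)]
      have := h₁.abs_damping_le.trans (by norm_num : (1 : ℝ) / 10 ^ 30 ≤ 1 / 2)
      nlinarith [h₁.q_le, h₁.le_q, abs_nonneg b]
    linarith [neg_abs_le (b * q₁)]
  nlinarith

end HalfOrbit

section Pair

variable {ψ : ℝ → ℝ} {a ε q₁ r₁ q₂ r₂ s₁ t₁ s₂ t₂ : ℝ} {Y₁ Y₂ Z₁ Z₂ : ℝ → ℝ}

/-- This and the next three bounds convert between the vertical gap of two orbits and the width of
their entry or exit interval. On one side of the layer the gap evolves by an exact exponential; on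
the interval the speed is estimated by its monotone factors, each taken at the unfavourable
endpoint. -/
theorem log_upper_damped (ha : 0 < a) (h₁ : HalfOrbit ψ a ε Y₁ q₁ r₁)
    (h₂ : HalfOrbit ψ a ε Y₂ q₂ r₂) (hq : q₁ < q₂) :
    log (1 + 2 * cos (π * q₂)) + log (sin (π * q₁ / 2)) + log (q₂ - q₁) ≤
      log (Y₂ 0 - Y₁ 0) - a * q₁ := by
  have hq1 := h₁.le_q
  have hq2 := h₂.q_le
  have p1 := le_one_add_two_cos (x := q₂) (by linarith) (by linarith)
  have p2 := le_sin_half (x := q₁) (by linarith) (by linarith)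
  have h3 := image_sub_le_of_hasDerivAt hq.le h₂.sol
    (C := -((1 + 2 * cos (π * q₂)) * sin (π * q₁ / 2))) (fun x hx => by
      have hx' : x ∈ Icc 0 q₂ := ⟨by linarith [hx.1], hx.2⟩
      rw [h₂.field_upper hx', sin_three_mul_half]
      have c1 := cos_pi_mul_le_cos_pi_mul (x := x) (y := q₂) (by linarith [hx.1]) hx.2
        (by linarith)
      have c2 := sin_half_le_sin_half (x := q₁) (y := x) (by linarith) hx.1 (by linarith [hx.2])
      have c3 := mul_le_mul (by linarith : 1 + 2 * cos (π * q₂) ≤ 1 + 2 * cos (π * x)) c2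
        (by linarith) (by linarith)
      have := h₂.upper x hx'
      have := h₂.eps_pos
      nlinarith)
  rw [h₂.at_q] at h3
  have h4 := h₁.exp_mul_sub_upper h₂ hq.le
  have hpos : 0 < (1 + 2 * cos (π * q₂)) * sin (π * q₁ / 2) :=
    mul_pos (by linarith) (by linarith)
  have hw : 0 < q₂ - q₁ := by linarith
  have h5 := log_le_log (mul_pos hpos hw) (by linarith :
    (1 + 2 * cos (π * q₂)) * sin (π * q₁ / 2) * (q₂ - q₁) ≤ Y₂ q₁ - ε)
  rw [log_mul hpos.ne' hw.ne', log_mul (by linarith) (by linarith)] at h5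
  have hne : Y₂ q₁ - ε ≠ 0 := by
    have := mul_pos hpos hw
    linarith
  rw [← h4, log_mul (exp_pos _).ne' hne, log_exp]
  linarith

theorem log_upper_reversed (ha : 0 < a) (h₁ : HalfOrbit ψ (-a) ε Z₁ s₁ t₁)
    (h₂ : HalfOrbit ψ (-a) ε Z₂ s₂ t₂) (hlt : Z₁ 0 < Z₂ 0) (hs : s₁ < s₂) :
    log (Z₂ 0 - Z₁ 0) + a * s₁ ≤
      log (1 + 2 * cos (π * s₁)) + log (sin (π * s₂ / 2)) + log (s₂ - s₁) := by
  have hq1 := h₁.le_q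
  have hq2 := h₂.q_le
  have p1 := le_one_add_two_cos (x := s₁) (by linarith) (by linarith)
  have p2 := le_sin_half (x := s₂) (by linarith) (by linarith)
  have h3 := le_image_sub_of_hasDerivAt hs.le h₂.sol
    (C := -((1 + 2 * cos (π * s₁)) * sin (π * s₂ / 2))) (fun x hx => by
      have hx' : x ∈ Icc 0 s₂ := ⟨by linarith [hx.1], hx.2⟩
      rw [h₂.field_upper hx', sin_three_mul_half]
      have c1 := cos_pi_mul_le_cos_pi_mul (x := s₁) (y := x) (by linarith) hx.1
        (by linarith [hx.2])
      have c2 := sin_half_le_sin_half (x := x) (y := s₂) (by linarith [hx.1]) hx.2 (by linarith)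
      have c4 := le_sin_half (x := x) (by linarith [hx.1]) (by linarith [hx.2])
      have c3 := mul_le_mul (by linarith : 1 + 2 * cos (π * x) ≤ 1 + 2 * cos (π * s₁)) c2
        (by linarith [hx.1]) (by linarith)
      have := h₂.upper x hx'
      have := h₂.eps_pos
      nlinarith)
  rw [h₂.at_q] at h3
  have h4 := h₁.exp_mul_sub_upper h₂ hs.le
  have hpos : 0 < (1 + 2 * cos (π * s₁)) * sin (π * s₂ / 2) :=
    mul_pos (by linarith) (by linarith)
  have hw : 0 < s₂ - s₁ := by linarith
  have hZ : 0 < Z₂ s₁ - ε := by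
    have : 0 < exp (-a * s₁) * (Z₂ s₁ - ε) := by rw [h4]; linarith
    exact pos_of_mul_pos_right this (exp_pos _).le
  have h5 := log_le_log hZ (by linarith : Z₂ s₁ - ε ≤
    (1 + 2 * cos (π * s₁)) * sin (π * s₂ / 2) * (s₂ - s₁))
  rw [log_mul hpos.ne' hw.ne', log_mul (by linarith) (by linarith)] at h5
  rw [← h4, log_mul (exp_pos _).ne' hZ.ne', log_exp]
  linarith

theorem log_lower_damped (ha : 0 < a) (h₁ : HalfOrbit ψ a ε Y₁ q₁ r₁)
    (h₂ : HalfOrbit ψ a ε Y₂ q₂ r₂) (hlt : Y₁ 2 < Y₂ 2) (hr : r₁ < r₂) :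
    log (Y₂ 2 - Y₁ 2) ≤ a * (r₂ - 2) + log (sin (π * r₂ / 2)) + log (r₂ - r₁) := by
  have hr1 := h₁.le_q.trans h₁.q_le_r
  have hr2 := h₂.r_le
  have p2 := le_sin_half (x := r₂) (by linarith) (by linarith)
  have h3 := le_image_sub_of_hasDerivAt hr.le h₁.sol (C := -sin (π * r₂ / 2)) (fun x hx => by
    have hx' : x ∈ Icc r₁ 2 := ⟨hx.1, by linarith [hx.2]⟩
    rw [h₁.field_lower hx']
    have c2 := sin_half_le_sin_half (x := x) (y := r₂) (by linarith [hx.1]) hx.2 (by linarith)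
    have := h₁.lower x hx'
    have := h₁.eps_pos
    nlinarith)
  rw [h₁.at_r] at h3
  have h4 := h₁.exp_mul_sub_lower h₂ hr.le
  have hY : 0 < -ε - Y₁ r₂ := by
    have : 0 < exp (a * r₂) * (-ε - Y₁ r₂) := by
      rw [← h4]; exact mul_pos (exp_pos _) (by linarith)
    exact pos_of_mul_pos_right this (exp_pos _).le
  have h5 := log_le_log hY (by linarith : -ε - Y₁ r₂ ≤ sin (π * r₂ / 2) * (r₂ - r₁))
  rw [log_mul (by linarith) (by linarith)] at h5
  have h6 := congrArg log h4
  rw [log_mul (exp_pos _).ne' (by linarith), log_mul (exp_pos _).ne' hY.ne', log_exp,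
    log_exp] at h6
  linarith

theorem log_lower_reversed (ha : 0 < a) (h₁ : HalfOrbit ψ (-a) ε Z₁ s₁ t₁)
    (h₂ : HalfOrbit ψ (-a) ε Z₂ s₂ t₂) (hlt : Z₁ 2 < Z₂ 2) (ht : t₁ < t₂) :
    a * (2 - t₂) + log (sin (π * t₁ / 2)) + log (t₂ - t₁) ≤ log (Z₂ 2 - Z₁ 2) := by
  have hr1 := h₁.le_q.trans h₁.q_le_r
  have hr2 := h₂.r_le
  have p2 := le_sin_half (x := t₁) (by linarith) (by linarith)
  have h3 := image_sub_le_of_hasDerivAt ht.le h₁.sol (C := -sin (π * t₁ / 2)) (fun x hx => by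
    have hx' : x ∈ Icc t₁ 2 := ⟨hx.1, by linarith [hx.2]⟩
    rw [h₁.field_lower hx']
    have c2 := sin_half_le_sin_half (x := t₁) (y := x) (by linarith) hx.1 (by linarith [hx.2])
    have := h₁.lower x hx'
    have := h₁.eps_pos
    nlinarith)
  rw [h₁.at_r] at h3
  have h4 := h₁.exp_mul_sub_lower h₂ ht.le
  have hpos : 0 < sin (π * t₁ / 2) * (t₂ - t₁) := mul_pos (by linarith) (by linarith)
  have h5 := log_le_log hpos (by linarith : sin (π * t₁ / 2) * (t₂ - t₁) ≤ -ε - Z₁ t₂)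
  rw [log_mul (by linarith) (by linarith)] at h5
  have h6 := congrArg log h4
  rw [log_mul (exp_pos _).ne' (by linarith), log_mul (exp_pos _).ne' (by linarith), log_exp,
    log_exp] at h6
  linarith

/-- The delay of the reversed orbit, q₁ ≤ s₁, has the favourable sign because cos πx decreases, so
its size does not matter; only the width q₂ - q₁ costs something. -/
theorem log_cos_factor_le (ha : 0 < a) (hq : 3 / 10 ≤ q₁) (hqq : q₁ ≤ q₂)
    (hq2 : q₂ ≤ 2 / 3 - 1 / 5000) (hqs : q₁ ≤ s₁) (hs : s₁ ≤ 2 / 3 - 1 / 5000)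
    (hw : q₂ - q₁ ≤ a / 10 ^ 8) :
    log (1 + 2 * cos (π * s₁)) ≤ log (1 + 2 * cos (π * q₂)) + a / 4 := by
  have p1 := le_one_add_two_cos (x := s₁) (by linarith) hs
  have p2 := le_one_add_two_cos (x := q₂) (by linarith) hq2
  have c1 := cos_pi_mul_le_cos_pi_mul (x := q₁) (y := s₁) (by linarith) hqs (by linarith)
  have c2 := abs_cos_sub_cos_le (π * q₁) (π * q₂)
  rw [← mul_sub, abs_mul, abs_of_pos pi_pos, abs_sub_comm q₁,
    abs_of_nonneg (by linarith : 0 ≤ q₂ - q₁)] at c2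
  have c3 := (abs_le.1 c2).2
  refine log_le_log_add (by linarith) (by linarith) (by linarith) ?_
  have : π * (q₂ - q₁) ≤ 4 * (a / 10 ^ 8) :=
    mul_le_mul pi_le_four hw (by linarith) (by norm_num)
  nlinarith

/-- The product-to-sum formula makes the error depend on the sum and the difference of the
arguments. For exit and entry phases the sums nearly agree, since the layer almost preserves
displacements, and the differences are tiny. -/
theorem log_sin_factor_le {x₁ x₂ y₁ y₂ : ℝ} (ha : 0 < a) (hx : ∀ x ∈ ({x₁, x₂, y₁, y₂} : Set ℝ),
    x ∈ Icc (3 / 10 : ℝ) 1) (h1 : |x₁ + x₂ - (y₁ + y₂)| ≤ a / 10 ^ 5)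
    (h2 : |(x₁ - x₂) + (y₁ - y₂)| * |(x₁ - x₂) - (y₁ - y₂)| ≤ a / 10 ^ 5) :
    log (sin (π * x₁ / 2)) + log (sin (π * x₂ / 2)) ≤
      log (sin (π * y₁ / 2)) + log (sin (π * y₂ / 2)) + a / 4 := by
  have hs : ∀ x ∈ ({x₁, x₂, y₁, y₂} : Set ℝ), 3 / 10 ≤ sin (π * x / 2) := fun x hm =>
    (hx x hm).1.trans (le_sin_half (by linarith [(hx x hm).1]) (hx x hm).2)
  have e1 := hs x₁ (by simp)
  have e2 := hs x₂ (by simp)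
  have e3 := hs y₁ (by simp)
  have e4 := hs y₂ (by simp)
  rw [← log_mul (by linarith) (by linarith), ← log_mul (by linarith) (by linarith)]
  refine log_le_log_add (by nlinarith) (by nlinarith) (by linarith) ?_
  have i1 : sin (π * x₁ / 2) * sin (π * x₂ / 2) =
      (cos (π * x₁ / 2 - π * x₂ / 2) - cos (π * x₁ / 2 + π * x₂ / 2)) / 2 := by
    rw [cos_sub, cos_add]; ring
  have i2 : sin (π * y₁ / 2) * sin (π * y₂ / 2) =
      (cos (π * y₁ / 2 - π * y₂ / 2) - cos (π * y₁ / 2 + π * y₂ / 2)) / 2 := by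
    rw [cos_sub, cos_add]; ring
  have c1 := abs_cos_sub_cos_le (π * x₁ / 2 + π * x₂ / 2) (π * y₁ / 2 + π * y₂ / 2)
  have c2 := abs_cos_sub_cos_le_mul (π * x₁ / 2 - π * x₂ / 2) (π * y₁ / 2 - π * y₂ / 2)
  rw [show π * x₁ / 2 + π * x₂ / 2 - (π * y₁ / 2 + π * y₂ / 2) =
    π / 2 * (x₁ + x₂ - (y₁ + y₂)) by ring, abs_mul, abs_of_pos (by positivity : 0 < π / 2)] at c1
  rw [show π * x₁ / 2 - π * x₂ / 2 + (π * y₁ / 2 - π * y₂ / 2) =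
    π / 2 * ((x₁ - x₂) + (y₁ - y₂)) by ring, show π * x₁ / 2 - π * x₂ / 2 -
    (π * y₁ / 2 - π * y₂ / 2) = π / 2 * ((x₁ - x₂) - (y₁ - y₂)) by ring, abs_mul, abs_mul,
    abs_of_pos (by positivity : 0 < π / 2)] at c2
  have c3 := (abs_le.1 c1).1
  have c4 := (abs_le.1 c2).2
  have hπ : π / 2 ≤ 2 := by linarith [pi_le_four]
  have f1 : π / 2 * |x₁ + x₂ - (y₁ + y₂)| ≤ 2 * (a / 10 ^ 5) :=
    mul_le_mul hπ h1 (abs_nonneg _) (by norm_num)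
  have f2 : π / 2 * |(x₁ - x₂) + (y₁ - y₂)| * (π / 2 * |(x₁ - x₂) - (y₁ - y₂)|) ≤
      4 * (a / 10 ^ 5) := by
    have : (π / 2) * (π / 2) ≤ 4 := by nlinarith [pi_pos]
    have g := mul_le_mul this h2 (by positivity) (by norm_num)
    linarith
  have e5 : 9 / 100 ≤ sin (π * y₁ / 2) * sin (π * y₂ / 2) := by nlinarith
  nlinarith

/-- Damped half-orbits approach each other relative to their reversals. -/
theorem end_sub_le_exp_mul (ha : 0 < a) (h₁ : HalfOrbit ψ a ε Y₁ q₁ r₁)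
    (h₂ : HalfOrbit ψ a ε Y₂ q₂ r₂) (k₁ : HalfOrbit ψ (-a) ε Z₁ s₁ t₁)
    (k₂ : HalfOrbit ψ (-a) ε Z₂ s₂ t₂) (e₁ : Y₁ 0 = Z₁ 0) (e₂ : Y₂ 0 = Z₂ 0)
    (hlt : Y₁ 0 < Y₂ 0) (hd : Y₂ 0 - Y₁ 0 ≤ a / 10 ^ 13) :
    Y₂ 2 - Y₁ 2 ≤ exp (-a) * (Z₂ 2 - Z₁ 2) := by
  have hε := h₁.eps_pos
  have hε1 := h₁.eps_le
  have hψ := h₁.transition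
  have ha1 : a ≤ 1 / 10 ^ 30 := by
    have := h₁.abs_damping_le
    rwa [abs_of_pos ha] at this
  norm_num at hε1 ha1
  have hY := h₁.sol.lt_of_lt_at hψ hε h₂.sol hlt
  have hZ := k₁.sol.lt_of_lt_at hψ hε k₂.sol (x₀ := 0) (by rw [← e₁, ← e₂]; exact hlt)
  obtain ⟨X₁, l₁⟩ := h₁.exists_layerCurve
  obtain ⟨X₂, l₂⟩ := h₂.exists_layerCurve
  obtain ⟨V₁, m₁⟩ := k₁.exists_layerCurve
  obtain ⟨V₂, m₂⟩ := k₂.exists_layerCurve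
  have v1 : (1 : ℝ) ∈ Icc (-1 : ℝ) 1 := by norm_num
  have v2 : (-1 : ℝ) ∈ Icc (-1 : ℝ) 1 := by norm_num
  have hq : q₁ < q₂ := by simpa only [l₁.one, l₂.one] using layer_lt_of_lt h₁ h₂ l₁ l₂ hY v1
  have hr : r₁ < r₂ := by
    simpa only [l₁.neg_one, l₂.neg_one] using layer_lt_of_lt h₁ h₂ l₁ l₂ hY v2
  have hs : s₁ < s₂ := by simpa only [m₁.one, m₂.one] using layer_lt_of_lt k₁ k₂ m₁ m₂ hZ v1
  have ht : t₁ < t₂ := by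
    simpa only [m₁.neg_one, m₂.neg_one] using layer_lt_of_lt k₁ k₂ m₁ m₂ hZ v2
  have wq := h₁.entry_sub_le h₂ hq.le
  have ws := k₁.entry_sub_le k₂ hs.le
  rw [← e₁, ← e₂] at ws
  have hq1s1 := entry_le_entry ha h₁ k₁ e₁
  have hq2s2 := entry_le_entry ha h₂ k₂ e₂
  have hsq1 := entry_sub_entry_le ha h₁ k₁ e₁
  have hsq2 := entry_sub_entry_le ha h₂ k₂ e₂
  norm_num at hd
  have hsame : ∀ v ∈ Icc (-1 : ℝ) 1, X₂ v - X₁ v ≤ a / 10 ^ 8 := by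
    intro v hv
    have h := (abs_le.1 (abs_layer_sub_sub_le h₁ h₂ l₁ l₂ hv)).2
    rw [sub_self, abs_zero, abs_of_pos (by linarith : 0 < q₂ - q₁)] at h
    have : 10 ^ 9 * ε * (q₂ - q₁ + 0) ≤ 1 * (q₂ - q₁ + 0) :=
      mul_le_mul_of_nonneg_right (by linarith) (by linarith)
    norm_num
    linarith
  have hsame' : t₂ - t₁ ≤ a / 10 ^ 8 := by
    have h := (abs_le.1 (abs_layer_sub_sub_le k₁ k₂ m₁ m₂ v2)).2
    rw [sub_self, abs_zero, abs_of_pos (by linarith : 0 < s₂ - s₁), m₁.neg_one, m₂.neg_one] at h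
    have : 10 ^ 9 * ε * (s₂ - s₁ + 0) ≤ 1 * (s₂ - s₁ + 0) :=
      mul_le_mul_of_nonneg_right (by linarith) (by linarith)
    norm_num
    linarith
  have hcross : ∀ {u s u' s' : ℝ} {U W X V : ℝ → ℝ} (_ : HalfOrbit ψ a ε U u s)
      (_ : HalfOrbit ψ (-a) ε W u' s') (_ : LayerCurve ψ a ε u s U X)
      (_ : LayerCurve ψ (-a) ε u' s' W V), u ≤ u' → u' - u ≤ 20000 * a →
      ∀ v ∈ Icc (-1 : ℝ) 1, |(V v - X v) - (u' - u)| ≤ a / 10 ^ 8 := by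
    intro u s u' s' U W X V hU hW hX hV huu hu v hv
    have h := abs_layer_sub_sub_le hU hW hX hV hv
    rw [show -a - a = -(2 * a) by ring, abs_neg, abs_of_pos (by linarith : 0 < 2 * a),
      abs_of_nonneg (by linarith : 0 ≤ u' - u)] at h
    have : 10 ^ 9 * ε * (u' - u + 2 * a) ≤ 1 / 10 ^ 15 * (30000 * a) :=
      mul_le_mul (by norm_num; linarith) (by linarith) (by linarith) (by norm_num)
    refine h.trans (this.trans ?_)
    norm_num
    linarith
  have cr1 := hcross h₁ k₁ l₁ m₁ hq1s1 hsq1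
  have cr2 := hcross h₂ k₂ l₂ m₂ hq2s2 hsq2
  have hlog := (abs_le.1 (abs_log_separation_sub_le (D := 30000 * a) h₁ h₂ k₁ k₂ l₁ l₂ m₁ m₂ hY hZ
    (fun v hv => by
      have c1 := abs_le.1 (cr1 v hv)
      have c2 := abs_le.1 (cr2 v hv)
      have c3 := hsame v hv
      norm_num at c1 c2 c3
      refine ⟨?_, ?_, by linarith⟩ <;> rw [abs_le] <;> constructor <;> linarith))).2
  have hη : 10 ^ 18 * ε * (30000 * a + |a - -a|) ≤ a / 4 := by
    rw [sub_neg_eq_add, abs_of_pos (by linarith : 0 < a + a)]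
    have : 10 ^ 18 * ε * (30000 * a + (a + a)) ≤ 1 / 10 ^ 11 * (30000 * a + (a + a)) :=
      mul_le_mul_of_nonneg_right (by norm_num; linarith) (by linarith)
    norm_num at this ⊢
    linarith
  have A := log_lower_damped ha h₁ h₂ (hY 2) hr
  have B := log_lower_reversed ha k₁ k₂ (hZ 2) ht
  have C := log_upper_damped ha h₁ h₂ hq
  have D := log_upper_reversed ha k₁ k₂ (hZ 0) hs
  have b1 := h₁.le_q
  have b2 := h₁.q_le_r
  have b3 := h₂.r_le
  have b4 := h₂.q_le_r
  have b5 := k₁.le_q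
  have b6 := k₁.q_le_r
  have b7 := k₂.r_le
  have b8 := k₂.q_le_r
  have E := log_cos_factor_le (q₁ := q₁) (q₂ := q₂) (s₁ := s₁) ha b1 hq.le (by linarith) hq1s1
    (by linarith) (by norm_num; linarith)
  have d1 := h₂.r_sub_q_le
  have d2 := k₁.r_sub_q_le
  have d3 := k₂.r_sub_q_le
  have wr := hsame (-1) v2
  rw [l₁.neg_one, l₂.neg_one] at wr
  have cr := abs_le.1 (cr1 (-1) v2)
  rw [l₁.neg_one, m₁.neg_one] at cr
  norm_num at wr hsame' cr
  have F := log_sin_factor_le (a := a) (x₁ := r₂) (x₂ := s₂) (y₁ := t₁) (y₂ := q₁) ha (by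
      intro x hx
      simp only [mem_insert_iff, mem_singleton_iff] at hx
      rcases hx with rfl | rfl | rfl | rfl <;> constructor <;> linarith)
    (by
      norm_num
      rw [abs_le]
      constructor <;> linarith)
    (by
      have g1 : |(r₂ - s₂) + (t₁ - q₁)| ≤ 1 / 10 ^ 20 := by
        norm_num
        rw [abs_le]
        constructor <;> linarith
      have g2 : |(r₂ - s₂) - (t₁ - q₁)| ≤ 10 ^ 6 * a := by
        norm_num
        rw [abs_le]
        constructor <;> linarith
      have g3 := mul_le_mul g1 g2 (abs_nonneg _) (by norm_num)
      norm_num at g3 ⊢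
      linarith)
  -- The four gap bounds contribute -4a + a(r₂ - q₁) + a(t₂ - s₁) ≤ -3a; the layer, cosine and sine
  -- errors cost a/4 each.
  have hfin : log (Y₂ 2 - Y₁ 2) ≤ log (Z₂ 2 - Z₁ 2) - a := by
    have w1 : a * (r₂ - q₁) ≤ a * (1 / 2) := mul_le_mul_of_nonneg_left (by linarith) ha.le
    have w2 : a * (t₂ - s₁) ≤ a * (1 / 2) := mul_le_mul_of_nonneg_left (by linarith) ha.le
    rw [← e₁, ← e₂] at D
    linarith
  have pY : 0 < Y₂ 2 - Y₁ 2 := sub_pos.2 (hY 2)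
  have pZ : 0 < Z₂ 2 - Z₁ 2 := sub_pos.2 (hZ 2)
  have := exp_le_exp.2 hfin
  rw [sub_eq_add_neg (log _), exp_add, exp_log pY, exp_log pZ] at this
  linarith

end Pair

/-! ### The periodic solution and its stability. -/

section Periodic

variable {ψ : ℝ → ℝ} {a ε : ℝ}

/-- A solution of the damped equation that takes the same value at `x = -2` and `x = 2`, and which
starts inside the range of initial values of crossing half-orbits. -/
theorem exists_isSol_symmetric (hψ : IsTransition ψ) (ha : 0 < a) (ha1 : a ≤ 1 / 10 ^ 30)
    (hε : 0 < ε) (hε1 : ε ≤ 1 / 10 ^ 30) :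
    ∃ W, IsSol ψ a ε W ∧ W 2 = W (-2) ∧
      W 0 ∈ Ioo (2 / (3 * π)) (2 / (3 * π) * (1 - cos (3 * π * (2 / 3 - 1 / 2000) / 2))) := by
  have hab : |a| ≤ 1 / 10 ^ 30 := by rwa [abs_of_pos ha]
  have hab' : |-a| ≤ 1 / 10 ^ 30 := by rwa [abs_neg]
  choose F hF hF0 using exists_isSol hψ a hε 0
  choose G hG hG0 using exists_isSol hψ (-a) hε 0
  set cL := 2 / (3 * π) with hcL
  set cH := 2 / (3 * π) * (1 - cos (3 * π * (2 / 3 - 1 / 2000) / 2)) with hcH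
  have hLH : cL ≤ cH := by
    have : cos (3 * π * (2 / 3 - 1 / 2000) / 2) ≤ 0 := by
      have hπ := pi_pos
      apply cos_nonpos_of_pi_div_two_le_of_le <;> nlinarith
    have hk : 0 < cL := by positivity
    rw [hcH]
    nlinarith
  have hcontF : ∀ {b : ℝ} {H : ℝ → ℝ → ℝ}, (∀ c, IsSol ψ b ε (H c)) → (∀ c, H c 0 = c) →
      Continuous fun c => H c 2 := by
    intro b H hH hH0
    obtain ⟨K, hK⟩ := exists_lipschitz_field hψ b hε
    have : LipschitzWith ⟨exp (K * (2 - 0)), (exp_pos _).le⟩ fun c => H c 2 :=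
      LipschitzWith.of_dist_le_mul fun c d => by
        have := (hH c).dist_le_forward (hH d) hK (x₀ := 0) (x := 2) (by norm_num)
        rw [hH0, hH0, mul_comm] at this
        exact this
    exact this.continuous
  have hΔ : Continuous fun c => F c 2 - G c 2 := (hcontF hF hF0).sub (hcontF hG hG0)
  have hlow : 0 < F cL 2 - G cL 2 := by
    obtain ⟨q, r, hY⟩ := (hF cL).exists_halfOrbit hψ hε hε1 hab (by rw [hF0])
      (by rw [hF0]; exact hLH)
    obtain ⟨q', r', hZ⟩ := (hG cL).exists_halfOrbit hψ hε hε1 hab' (by rw [hG0])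
      (by rw [hG0]; exact hLH)
    exact sub_pos.2 (lt_end_of_initial_eq_low ha hY hZ (by rw [hF0, hG0]) (hF0 _))
  have hhigh : F cH 2 - G cH 2 < 0 := by
    obtain ⟨q, r, hY⟩ := (hF cH).exists_halfOrbit hψ hε hε1 hab (by rw [hF0]; exact hLH)
      (by rw [hF0])
    obtain ⟨q', r', hZ⟩ := (hG cH).exists_halfOrbit hψ hε hε1 hab' (by rw [hG0]; exact hLH)
      (by rw [hG0])
    exact sub_neg.2 (end_lt_of_initial_eq_high ha hY hZ (by rw [hF0, hG0]) (hF0 _))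
  obtain ⟨c, hc, hc0⟩ := intermediate_value_Icc' hLH hΔ.continuousOn ⟨hhigh.le, hlow.le⟩
  simp only at hc0
  refine ⟨F c, hF c, ?_, ?_⟩
  -- G c is the reflection of F c, so G c at 2 is F c at -2.
  · have := (hF c).reflect.eq_of_eq_at hψ hε (hG c) (x₀ := 0) (by simp only [neg_zero]; rw [hF0, hG0])
    have h2 : F c (-2) = G c 2 := congrFun this 2
    linarith
  · rw [hF0]
    refine ⟨lt_of_le_of_ne hc.1 fun h => ?_, lt_of_le_of_ne hc.2 fun h => ?_⟩
    · rw [← h] at hc0; linarith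
    · rw [h] at hc0; linarith

theorem IsSol.periodic {W : ℝ → ℝ} (hψ : IsTransition ψ) (hε : 0 < ε) (hW : IsSol ψ a ε W)
    (h : W 2 = W (-2)) : Function.Periodic W 4 := by
  have := hW.shift.eq_of_eq_at hψ hε hW (x₀ := -2) (by norm_num; exact h)
  exact fun x => congrFun this x

/-- `end_sub_le_exp_mul` applied to the orbits and their reflections. The radius keeps the neighbour
inside the range of crossing orbits and within the distance a/10^13 required there. -/
theorem exists_contraction {W : ℝ → ℝ} (hψ : IsTransition ψ) (ha : 0 < a) (ha1 : a ≤ 1 / 10 ^ 30)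
    (hε : 0 < ε) (hε1 : ε ≤ 1 / 10 ^ 30) (hW : IsSol ψ a ε W)
    (h0 : W 0 ∈ Ioo (2 / (3 * π)) (2 / (3 * π) * (1 - cos (3 * π * (2 / 3 - 1 / 2000) / 2)))) :
    ∃ h > 0, ∀ V, IsSol ψ a ε V → |V 0 - W 0| ≤ h →
      |V 2 - W 2| ≤ exp (-a) * |V (-2) - W (-2)| := by
  have hab : |a| ≤ 1 / 10 ^ 30 := by rwa [abs_of_pos ha]
  have hab' : |-a| ≤ 1 / 10 ^ 30 := by rwa [abs_neg]
  set cL := 2 / (3 * π) with hcL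
  set cH := 2 / (3 * π) * (1 - cos (3 * π * (2 / 3 - 1 / 2000) / 2)) with hcH
  have key : ∀ U V, IsSol ψ a ε U → IsSol ψ a ε V → U 0 ∈ Icc cL cH → V 0 ∈ Icc cL cH →
      U 0 < V 0 → V 0 - U 0 ≤ a / 10 ^ 13 → |V 2 - U 2| ≤ exp (-a) * |V (-2) - U (-2)| := by
    intro U V hU hV hU0 hV0 hlt hd
    obtain ⟨q₁, r₁, h₁⟩ := hU.exists_halfOrbit hψ hε hε1 hab hU0.1 hU0.2
    obtain ⟨q₂, r₂, h₂⟩ := hV.exists_halfOrbit hψ hε hε1 hab hV0.1 hV0.2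
    obtain ⟨s₁, t₁, k₁⟩ := hU.reflect.exists_halfOrbit hψ hε hε1 hab' (by simpa using hU0.1)
      (by simpa only [neg_zero] using hU0.2)
    obtain ⟨s₂, t₂, k₂⟩ := hV.reflect.exists_halfOrbit hψ hε hε1 hab' (by simpa using hV0.1)
      (by simpa only [neg_zero] using hV0.2)
    have := end_sub_le_exp_mul ha h₁ h₂ k₁ k₂ (by simp) (by simp) hlt hd
    have hl := hU.lt_of_lt_at hψ hε hV hlt
    rwa [abs_of_pos (sub_pos.2 (hl 2)), abs_of_pos (sub_pos.2 (hl (-2)))]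
  refine ⟨min (a / 10 ^ 13) (min (W 0 - cL) (cH - W 0)), lt_min (by positivity)
    (lt_min (by linarith [h0.1]) (by linarith [h0.2])), fun V hV hd => ?_⟩
  have d1 := hd.trans (min_le_left _ _)
  have d2 := (hd.trans (min_le_right _ _)).trans (min_le_left _ _)
  have d3 := (hd.trans (min_le_right _ _)).trans (min_le_right _ _)
  have hV0 : V 0 ∈ Icc cL cH :=
    ⟨by linarith [neg_abs_le (V 0 - W 0)], by linarith [le_abs_self (V 0 - W 0)]⟩
  have hW0 : W 0 ∈ Icc cL cH := ⟨h0.1.le, h0.2.le⟩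
  rcases lt_trichotomy (V 0) (W 0) with h | h | h
  · have := key V W hV hW hV0 hW0 h (by linarith [neg_abs_le (V 0 - W 0)])
    rwa [abs_sub_comm, abs_sub_comm (V (-2))]
  · rw [hV.eq_of_eq_at hψ hε hW h]; simp
  · exact key W V hW hV hW0 hV0 h (by linarith [le_abs_self (V 0 - W 0)])

/-- Asymptotic stability of a periodic solution whose return map contracts near it. -/
theorem exists_stability {W : ℝ → ℝ} (hψ : IsTransition ψ) (ha : 0 < a) (hε : 0 < ε)
    (hW : IsSol ψ a ε W) (hper : Function.Periodic W 4) {h : ℝ} (hh : 0 < h)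
    (hcon : ∀ V, IsSol ψ a ε V → |V 0 - W 0| ≤ h →
      |V 2 - W 2| ≤ exp (-a) * |V (-2) - W (-2)|) :
    ∃ h' > 0, ∃ C > 0, ∀ V, IsSol ψ a ε V → ∀ x₀, |V x₀ - W x₀| ≤ h' →
      (∀ x, x₀ ≤ x → |V x - W x| ≤ C * |V x₀ - W x₀|) ∧
      Tendsto (fun x => |V x - W x|) atTop (𝓝 0) := by
  obtain ⟨K, hK⟩ := exists_lipschitz_field hψ a hε
  set E := exp (K * 4) with hE
  have hE1 : 1 ≤ E := one_le_exp (by positivity)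
  have hgr : ∀ V, IsSol ψ a ε V → ∀ x₀ x, x₀ ≤ x → x ≤ x₀ + 4 →
      |V x - W x| ≤ E * |V x₀ - W x₀| := by
    intro V hV x₀ x h1 h2
    refine (hV.dist_le_forward hW hK h1).trans ?_
    rw [mul_comm]
    refine mul_le_mul_of_nonneg_right (exp_le_exp.2 ?_) (abs_nonneg _)
    exact mul_le_mul_of_nonneg_left (by linarith) K.2
  have hea : exp (-a) < 1 := by rw [exp_lt_one_iff]; linarith
  have hWn : ∀ (n : ℤ) x, W (x + 4 * n) = W x := fun n x => by
    rw [mul_comm]; exact hper.int_mul n x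
  have hbase : ∀ V, IsSol ψ a ε V → ∀ x₀ ∈ Icc (-2 : ℝ) 2, |V x₀ - W x₀| ≤ h / (E * E) →
      (∀ x, x₀ ≤ x → |V x - W x| ≤ E * E * |V x₀ - W x₀|) ∧
      Tendsto (fun x => |V x - W x|) atTop (𝓝 0) := by
    intro V hV x₀ hx₀ hd
    set δ := |V x₀ - W x₀| with hδ
    have hδ0 : 0 ≤ δ := abs_nonneg _
    have hEδ : E * (E * δ) ≤ h := by
      rw [le_div_iff₀ (by positivity)] at hd
      linarith
    -- The contraction acts from 4n + 2 to 4n + 6 but asks for closeness at the midpoint 4n + 4; one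
    -- more factor E, paid for by E(Eδ) ≤ h, supplies it.
    have hn : ∀ n : ℕ, |V (4 * n + 2) - W (4 * n + 2)| ≤ exp (-a) ^ n * (E * δ) := by
      intro n
      induction n with
      | zero =>
        simpa using hgr V hV x₀ 2 hx₀.2 (by linarith [hx₀.1])
      | succ n ih =>
        have hp1 : exp (-a) ^ n ≤ 1 := pow_le_one₀ (exp_pos _).le hea.le
        have h4 := hgr V hV (4 * n + 2) (4 * n + 4) (by linarith) (by linarith)
        have hle : |V (4 * n + 4) - W (4 * n + 4)| ≤ h := by
          refine h4.trans (le_trans (mul_le_mul_of_nonneg_left ?_ (by linarith)) hEδ)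
          refine ih.trans ?_
          have : 0 ≤ E * δ := by positivity
          nlinarith
        have hs := hcon _ (hV.shift_int (n + 1)) (by
          rw [← hWn (n + 1) 0]
          push_cast
          rwa [show 0 + 4 * ((n : ℝ) + 1) = 4 * n + 4 by ring])
        rw [← hWn (n + 1) 2, ← hWn (n + 1) (-2)] at hs
        push_cast at hs ⊢
        rw [show 2 + 4 * ((n : ℝ) + 1) = 4 * (n + 1) + 2 by ring,
          show -2 + 4 * ((n : ℝ) + 1) = 4 * n + 2 by ring] at hs
        refine hs.trans ?_
        rw [pow_succ, mul_comm (exp (-a) ^ n), mul_assoc]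
        exact mul_le_mul_of_nonneg_left ih (exp_pos _).le
    have hlarge : ∀ x, 2 ≤ x →
        |V x - W x| ≤ exp (-a) ^ ⌊(x - 2) / 4⌋₊ * (E * E * δ) := by
      intro x hx
      have f1 := Nat.floor_le (by linarith : 0 ≤ (x - 2) / 4)
      have f2 := Nat.lt_floor_add_one ((x - 2) / 4)
      refine (hgr V hV (4 * ⌊(x - 2) / 4⌋₊ + 2) x (by linarith) (by linarith)).trans ?_
      have := mul_le_mul_of_nonneg_left (hn ⌊(x - 2) / 4⌋₊) (by linarith : 0 ≤ E)
      linarith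
    constructor
    · intro x hx
      rcases le_total x 2 with h2 | h2
      · refine (hgr V hV x₀ x hx (by linarith [hx₀.1])).trans ?_
        have : 0 ≤ E * δ := by positivity
        nlinarith
      · refine (hlarge x h2).trans ?_
        have : exp (-a) ^ ⌊(x - 2) / 4⌋₊ ≤ 1 := pow_le_one₀ (exp_pos _).le hea.le
        have : 0 ≤ E * E * δ := by positivity
        nlinarith
    · have hfl : Tendsto (fun x : ℝ => ⌊(x - 2) / 4⌋₊) atTop atTop :=
        tendsto_nat_floor_atTop.comp
          ((tendsto_atTop_add_const_right _ (-2) tendsto_id).atTop_div_const (by norm_num))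
      have hpow := ((tendsto_pow_atTop_nhds_zero_of_lt_one (exp_pos (-a)).le hea).comp hfl).mul_const
        (E * E * δ)
      rw [zero_mul] at hpow
      refine squeeze_zero' (Eventually.of_forall fun x => abs_nonneg _) ?_ hpow
      filter_upwards [eventually_ge_atTop 2] with x hx using hlarge x hx
  refine ⟨h / (E * E), by positivity, E * E, by positivity, fun V hV x₀ hd => ?_⟩
  -- Translation by this multiple of the period brings the starting phase into [-2, 2).
  set n := ⌊(x₀ + 2) / 4⌋ with hnd
  have f1 := Int.floor_le ((x₀ + 2) / 4)
  have f2 := Int.lt_floor_add_one ((x₀ + 2) / 4)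
  rw [← hnd] at f1 f2
  have e0 : ∀ x : ℝ, x - 4 * n + 4 * n = x := fun x => by ring
  have hmain := hbase _ (hV.shift_int n) (x₀ - 4 * n) ⟨by linarith, by linarith⟩ (by
    rwa [← hWn n (x₀ - 4 * n), e0])
  simp only [← hWn n (x₀ - 4 * n), e0] at hmain
  refine ⟨fun x hx => ?_, ?_⟩
  · have := hmain.1 (x - 4 * n) (by linarith)
    rwa [← hWn n (x - 4 * n), e0] at this
  · have hsub : Tendsto (fun x : ℝ => x - 4 * n) atTop atTop :=
      tendsto_atTop_add_const_right _ (-(4 * (n : ℝ))) tendsto_id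
    refine (hmain.2.comp hsub).congr fun x => ?_
    simp only [Function.comp]
    rw [← hWn n (x - 4 * n), e0]

end Periodic

/-! ### Return to the planar system. -/

namespace HalfOrbit

variable {ψ : ℝ → ℝ} {b ε : ℝ} {Y : ℝ → ℝ} {q r : ℝ}

/-- Over the phases at which a half-orbit is in the layer the critical manifold is empty. -/
theorem forcing_ne_zero_of_abs_lt (h : HalfOrbit ψ b ε Y q r) {x : ℝ} (hx : x ∈ Icc (0 : ℝ) 2)
    (hY : |Y x| < ε) (w : ℝ) : forcing x (ψ w) ≠ 0 := by
  have hY' := abs_lt.1 hY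
  have h1 : q ≤ x := by
    by_contra hcon
    linarith [h.upper x ⟨hx.1, (not_le.1 hcon).le⟩]
  have h2 : x ≤ r := by
    by_contra hcon
    linarith [h.lower x ⟨(not_le.1 hcon).le, hx.2⟩]
  have := le_forcing (h.le_q.trans h1) (h2.trans h.r_le) (h.transition.abs_le_one w)
  linarith

end HalfOrbit

/-- The orbit in the `(x, v)` plane given by a solution of the scalar equation. -/
noncomputable def orbit (ε : ℝ) (W : ℝ → ℝ) (t : ℝ) : ℝ × ℝ := (t, W t / ε)

section Orbit

variable {ψ : ℝ → ℝ} {a ε : ℝ} {W : ℝ → ℝ}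

theorem IsSol.isIntegralCurve_orbit (hε : 0 < ε) (hW : IsSol ψ a ε W) :
    IsIntegralCurve (orbit ε W) (fun _ => regField ψ a ε) := by
  intro t
  refine ((hasDerivAt_id t).prodMk ((hW t).div_const ε)).congr_deriv ?_
  simp only [regField, orbit]
  rw [mul_assoc, mul_div_cancel₀ _ hε.ne']

theorem hasLeastPeriod_orbit (hε : 0 < ε) (hW : IsSol ψ a ε W) (hper : Function.Periodic W 4)
    {q r : ℝ} (h : HalfOrbit ψ a ε W q r) : HasLeastPeriod (orbit ε W) 4 := by
  refine ⟨by norm_num, fun t => ?_, fun S hS hper' => ?_⟩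
  · simp only [orbit, Prod.mk_add_mk, add_zero, hper t]
  by_contra hcon
  have hcon := not_le.1 hcon
  have hWS : ∀ t, W (t + S) = W t := fun t => by
    have := congrArg Prod.snd (hper' t)
    simp only [orbit, Prod.mk_add_mk, add_zero] at this
    exact (div_left_inj' hε.ne').1 this
  have h2 : W 2 ≤ -ε := h.lower 2 ⟨by linarith [h.r_le], le_rfl⟩
  have h0 : ε ≤ W 0 := h.upper 0 ⟨le_rfl, by linarith [h.le_q]⟩
  -- At 2 and 2 + S the solution has the same value, below the layer, and the same derivative, so
  -- sin(πS/2) = 0. With 0 < S < 4 this forces S = 2, excluded by W(0) > 0 > W(2).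
  have hd := (hW (2 + S)).comp_add_const 2 S
  rw [show (fun x => W (x + S)) = W from funext hWS, hWS] at hd
  have he := hd.unique (hW 2)
  rw [h.transition.eq_neg_one (W 2 / ε) (by rw [div_le_iff₀ hε]; linarith), forcing_neg_one,
    forcing_neg_one, show π * (2 + S) / 2 = π * S / 2 + π by ring, sin_add_pi,
    show π * 2 / 2 = π by ring, sin_pi] at he
  have hsin : sin (π * S / 2) = 0 := by linarith
  obtain ⟨n, hn⟩ := sin_eq_zero_iff.1 hsin
  have hnS : (n : ℝ) = S / 2 := by
    have hπ := pi_pos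
    have : π * (n - S / 2) = 0 := by linear_combination hn
    rcases mul_eq_zero.1 this with h | h
    · exact absurd h hπ.ne'
    · linarith
  have n1 : (0 : ℝ) < n := by rw [hnS]; linarith
  have n2 : (n : ℝ) < 2 := by rw [hnS]; linarith
  have n3 : 0 < n := by exact_mod_cast n1
  have n4 : n < 2 := by exact_mod_cast n2
  have n5 : n = 1 := by omega
  rw [n5] at hnS
  push_cast at hnS
  have := hWS 0
  rw [show (0 : ℝ) + S = 2 by linarith] at this
  linarith

theorem nonSliding_orbit (hε : 0 < ε) (hper : Function.Periodic W 4) {q r q' r' : ℝ}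
    (h : HalfOrbit ψ a ε W q r) (h' : HalfOrbit ψ (-a) ε (fun x => W (-x)) q' r') :
    NonSliding ψ (orbit ε W) := by
  have key : ∀ x ∈ Icc (-2 : ℝ) 2, |W x| < ε → ∀ w, forcing x (ψ w) ≠ 0 := by
    intro x hx hW w
    rcases le_total 0 x with h0 | h0
    · exact h.forcing_ne_zero_of_abs_lt ⟨h0, hx.2⟩ hW w
    · have := h'.forcing_ne_zero_of_abs_lt (x := -x) ⟨by linarith, by linarith [hx.1]⟩
        (by simpa using hW) w
      rw [forcing_neg] at this
      exact neg_ne_zero.1 this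
  intro t ht w hw
  simp only [orbit] at ht hw
  rw [abs_div, abs_of_pos hε, div_lt_one hε] at ht
  set n := ⌊(t + 2) / 4⌋ with hnd
  have f1 := Int.floor_le ((t + 2) / 4)
  have f2 := Int.lt_floor_add_one ((t + 2) / 4)
  rw [← hnd] at f1 f2
  have hfp : Function.Periodic (fun x => forcing x (ψ w)) 4 := fun x => forcing_add_four x _
  refine key (t - n * 4) ⟨by linarith, by linarith⟩ ?_ w ?_
  · rwa [hper.sub_int_mul_eq n]
  · exact (hfp.sub_int_mul_eq n).trans hw.1

/-- The phase advances at unit speed, so εv solves the scalar equation along the curve and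
uniqueness applies. Stability of planar solutions thus reduces to the scalar equation. -/
theorem integralCurve_eq_of_isSol {V : ℝ → ℝ} (hψ : IsTransition ψ) (hε : 0 < ε)
    {σ : ℝ → ℝ × ℝ} (hσ : IsIntegralCurveOn σ (fun _ => regField ψ a ε) (Ici 0))
    (hV : IsSol ψ a ε V) (h0 : V (σ 0).1 = ε * (σ 0).2) {t : ℝ} (ht : 0 ≤ t) :
    σ t = orbit ε V ((σ 0).1 + t) := by
  have d1 : ∀ s ∈ Ici (0 : ℝ), HasDerivWithinAt (fun s => (σ s).1) 1 (Ici 0) s :=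
    fun s hs => (hσ s hs).fst
  have d2 : ∀ s ∈ Ici (0 : ℝ), HasDerivWithinAt (fun s => (σ s).2)
      ((-(a * ε * (σ s).2) - forcing (σ s).1 (ψ (σ s).2)) / ε) (Ici 0) s :=
    fun s hs => (hσ s hs).snd
  have e1 : ∀ s, 0 ≤ s → (σ s).1 = (σ 0).1 + s := by
    intro s hs
    have := ODE_solution_unique (v := fun _ _ => (1 : ℝ)) (K := 0) (a := 0) (b := s)
      (f := fun s => (σ s).1) (g := fun s => (σ 0).1 + s) (fun _ => LipschitzWith.const 1)
      (fun u hu => ((d1 u hu.1).continuousWithinAt).mono Icc_subset_Ici_self)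
      (fun u hu => (d1 u hu.1).mono (Ici_subset_Ici.2 hu.1)) (by fun_prop)
      (fun u _ => ((hasDerivAt_id u).const_add _).hasDerivWithinAt) (by simp)
    exact this (right_mem_Icc.2 hs)
  obtain ⟨K, hK⟩ := exists_lipschitz_field hψ a hε
  have e2 := ODE_solution_unique (K := K) (a := 0) (b := t)
    (v := fun s y => -(a * y) - forcing ((σ 0).1 + s) (ψ (y / ε)))
    (f := fun s => ε * (σ s).2) (g := fun s => V ((σ 0).1 + s)) (fun s => hK _)
    (fun u hu => (((d2 u hu.1).continuousWithinAt).mono Icc_subset_Ici_self).const_mul ε)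
    (fun u hu => by
      refine (((d2 u hu.1).const_mul ε).mono (Ici_subset_Ici.2 hu.1)).congr_deriv ?_
      rw [e1 u hu.1, mul_div_cancel_left₀ _ hε.ne', mul_div_cancel₀ _ hε.ne']
      ring)
    (hV.continuous.comp (continuous_const.add continuous_id)).continuousOn
    (fun u _ => ((hV _).comp_const_add (σ 0).1 u).hasDerivWithinAt) (by simp [h0])
    (right_mem_Icc.2 ht)
  simp only at e2
  refine Prod.ext (e1 t ht) ?_
  simp only [orbit]
  rw [← e2, mul_div_cancel_left₀ _ hε.ne']

theorem IsSol.exists_abs_sub_le (hψ : IsTransition ψ) (hW : IsSol ψ a ε W)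
    (hper : Function.Periodic W 4) : ∃ M > 0, ∀ x y, |W x - W y| ≤ M * |x - y| := by
  obtain ⟨B, hB⟩ := (hper.compact_of_continuous (by norm_num) hW.continuous).isBounded.exists_norm_le
  have hB' : ∀ x, |W x| ≤ B := fun x => hB _ (mem_range_self x)
  have hB0 : 0 ≤ B := (abs_nonneg _).trans (hB' 0)
  refine ⟨|a| * B + 1, by positivity, fun x y => ?_⟩
  have := Convex.norm_image_sub_le_of_norm_hasDerivWithin_le (f := W) (s := univ)
    (C := |a| * B + 1) (x := y) (y := x) (fun z _ => (hW z).hasDerivWithinAt) (fun z _ => by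
      rw [Real.norm_eq_abs]
      refine (abs_sub _ _).trans ?_
      rw [abs_neg, abs_mul]
      exact add_le_add (mul_le_mul_of_nonneg_left (hB' z) (abs_nonneg a))
        (abs_forcing_le_one z (hψ.abs_le_one _))) convex_univ (mem_univ _) (mem_univ _)
  simpa only [Real.norm_eq_abs] using this

theorem isLocallyAsymptoticallyStable_orbit (hψ : IsTransition ψ) (hε : 0 < ε)
    (hW : IsSol ψ a ε W) (hper : Function.Periodic W 4)
    (hstab : ∃ h' > 0, ∃ C > 0, ∀ V, IsSol ψ a ε V → ∀ x₀, |V x₀ - W x₀| ≤ h' →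
      (∀ x, x₀ ≤ x → |V x - W x| ≤ C * |V x₀ - W x₀|) ∧
      Tendsto (fun x => |V x - W x|) atTop (𝓝 0)) :
    IsLocallyAsymptoticallyStable (regField ψ a ε) (range (orbit ε W)) := by
  obtain ⟨h, hh, C, hC, hst⟩ := hstab
  obtain ⟨M, hM, hlip⟩ := hW.exists_abs_sub_le hψ hper
  have hne : (range (orbit ε W)).Nonempty := range_nonempty _
  -- The nearest orbit points may lie over another phase; the Lipschitz constant M of W turns planar
  -- distance into vertical deviation at the same phase.
  have hstart : ∀ (p : ℝ × ℝ) (δ : ℝ), Metric.infDist p (range (orbit ε W)) < δ →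
      |ε * p.2 - W p.1| ≤ (ε + M) * δ := by
    intro p δ hp
    obtain ⟨_, ⟨s, rfl⟩, hs⟩ := (Metric.infDist_lt_iff hne).1 hp
    rw [Prod.dist_eq, max_lt_iff, Real.dist_eq, Real.dist_eq] at hs
    simp only [orbit] at hs
    have h1 := hlip s p.1
    rw [abs_sub_comm s] at h1
    have h2 : |ε * p.2 - W s| ≤ ε * δ := by
      have : ε * p.2 - W s = ε * (p.2 - W s / ε) := by
        field_simp
      rw [this, abs_mul, abs_of_pos hε]
      exact mul_le_mul_of_nonneg_left hs.2.le hε.le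
    have h3 := abs_sub_le (ε * p.2) (W s) (W p.1)
    nlinarith [hs.1]
  have hdist : ∀ V : ℝ → ℝ, ∀ x,
      Metric.infDist (orbit ε V x) (range (orbit ε W)) ≤ |V x - W x| / ε := by
    intro V x
    refine (Metric.infDist_le_dist_of_mem (mem_range_self x)).trans ?_
    rw [Prod.dist_eq, Real.dist_eq, Real.dist_eq]
    simp only [orbit]
    rw [sub_self, abs_zero, ← sub_div, abs_div, abs_of_pos hε]
    exact max_le (by positivity) le_rfl
  constructor
  · intro η hη
    -- The factor 2 makes the final bound η/2, hence strictly less than η.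
    set δ := min h (η * ε / (2 * C)) / (ε + M) with hδ
    have hδ0 : 0 < δ := by positivity
    refine ⟨δ, hδ0, fun σ hσ hs t ht => ?_⟩
    have hsm := hstart _ _ hs
    rw [hδ, mul_div_cancel₀ _ (by positivity : ε + M ≠ 0)] at hsm
    obtain ⟨V, hV, hV0⟩ := exists_isSol hψ a hε (σ 0).1 (ε * (σ 0).2)
    rw [← hV0] at hsm
    rw [integralCurve_eq_of_isSol hψ hε hσ hV hV0 ht]
    refine (hdist V _).trans_lt ?_
    have := (hst V hV _ (hsm.trans (min_le_left _ _))).1 ((σ 0).1 + t) (by linarith)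
    have h2 := hsm.trans (min_le_right _ _)
    rw [le_div_iff₀ (by positivity)] at h2
    rw [div_lt_iff₀ hε]
    have : 0 < η * ε := by positivity
    linarith
  · refine ⟨h / (ε + M), by positivity, fun σ hσ hs => ?_⟩
    have hsm := hstart _ _ hs
    rw [mul_div_cancel₀ _ (by positivity : ε + M ≠ 0)] at hsm
    obtain ⟨V, hV, hV0⟩ := exists_isSol hψ a hε (σ 0).1 (ε * (σ 0).2)
    rw [← hV0] at hsm
    have hlim := (hst V hV _ hsm).2
    have hlim' := ((hlim.comp (tendsto_atTop_add_const_left atTop (σ 0).1 tendsto_id))).div_const ε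
    rw [zero_div] at hlim'
    refine squeeze_zero' (Eventually.of_forall fun t => Metric.infDist_nonneg) ?_ hlim'
    filter_upwards [eventually_ge_atTop 0] with t ht
    rw [integralCurve_eq_of_isSol hψ hε hσ hV hV0 ht]
    exact hdist V _

end Orbit

end SwitchedOscillator

open SwitchedOscillator

theorem mainTheorem6 (ψ : ℝ → ℝ) (hψ : SwitchedOscillator.IsTransition ψ) :
    ∃ a₀ : ℝ, 0 < a₀ ∧ ∃ ε₀ : ℝ, 0 < ε₀ ∧
      ∀ a : ℝ, 0 < a → a < a₀ → ∀ ε : ℝ, 0 < ε → ε < ε₀ →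
        ∃ γ : ℝ → ℝ × ℝ,
          IsIntegralCurve γ (fun _ => SwitchedOscillator.regField ψ a ε) ∧
          SwitchedOscillator.HasLeastPeriod γ 4 ∧
          SwitchedOscillator.NonSliding ψ γ ∧
          SwitchedOscillator.IsLocallyAsymptoticallyStable
            (SwitchedOscillator.regField ψ a ε) (Set.range γ) := by
  refine ⟨1 / 10 ^ 30, by norm_num, 1 / 10 ^ 30, by norm_num, fun a ha ha1 ε hε hε1 => ?_⟩
  obtain ⟨W, hW, hsymm, hW0⟩ := exists_isSol_symmetric hψ ha ha1.le hε hε1.le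
  have hper := hW.periodic hψ hε hsymm
  obtain ⟨q, r, h⟩ := hW.exists_halfOrbit hψ hε hε1.le (by rw [abs_of_pos ha]; exact ha1.le)
    hW0.1.le hW0.2.le
  obtain ⟨q', r', h'⟩ := hW.reflect.exists_halfOrbit hψ hε hε1.le
    (by rw [abs_neg, abs_of_pos ha]; exact ha1.le) (by simpa using hW0.1.le)
    (by simpa using hW0.2.le)
  obtain ⟨d, hd, hcon⟩ := exists_contraction hψ ha ha1.le hε hε1.le hW hW0
  exact ⟨orbit ε W, hW.isIntegralCurve_orbit hε, hasLeastPeriod_orbit hε hW hper h,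
    nonSliding_orbit hε hper h h', isLocallyAsymptoticallyStable_orbit hψ hε hW hper
      (exists_stability hψ ha hε hW hper hd hcon)⟩
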